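/- **Conventions.** Operators act on $\mathbb{C}[x]$; $x$ also denotes multiplication by $x$, $\mathrm D=\frac{d}{dx}$, and for a sequence $(s_n)_{n\ge0}$ the operator $s_\theta$ is $s_\theta\cdot x^n=s_nx^n$ (so $\theta=x\mathrm D$). For $f\in y+y^2\mathbb{C}[[y]]$ let $\mathrm C_f\cdot x^n=p_n(x)$, where $e^{xy}=\sum_n p_n(x)f(y)^n/n!$. A monic family $p_n$ ($\deg p_n=n$) has the invertible operator $\mathrm G\cdot x^n=p_n$ and the dual raising operator $\mathrm G^{-1}x\,\mathrm G$; it is called *orthogonal* if $\mathrm G^{-1}x\,\mathrm G=x+a_\theta+\mathrm D\,b_\theta$ for some sequences $a_n,b_n$ with all $b_n\ne0$ ($b_0$ plays no role). No positivity is required. **Data.** Let $\lambda,\kappa\in\mathbb{C}\setminus\{0\}$ with $\frac1\kappa-\frac1\lambda=\frac12$ and $1+\lambda n\neq0$, $1+\kappa n\ne0$ for all $n\ge0$. Let $a,r,\widetilde r,h\in\mathbb{C}$, $\beta=r\kappa+(1-r)\lambda$, $\widetilde\beta=\widetilde r\kappa+(1-\widetilde r)\lambda$, and $f(y)=y\,(1-\tfrac12\lambda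 a y)^{-1}$, so $f'=(1+\tfrac12\lambda a f)^2$, $f/f'=y-\tfrac12\lambda ay^2$, and $f'(y)^{-1/\lambda}=(1-\tfrac12\lambda ay)^{2/\lambda}$ (binomial series). Put $$\mathrm K=\mathrm C_{f/f'}^{-1}f'(\mathrm D)^{-1/\lambda}\mathrm C_f,\qquad \mathcal J_\gamma=\mathrm K^{-1}\,x\,\frac{1+\gamma\theta}{(1+\lambda\theta)(1+\kappa\theta)}\,\mathrm K\qquad(\gamma\in\mathbb C).$$ Let $\mathcal H_0=1$ and $$\frac{\mathcal H_{\theta+1}}{\mathcal H_\theta}=\frac{h(1+\beta\theta)(1+\lambda(\theta+1))^2+(1-h)(1+\widetilde\beta\theta)}{(1+\lambda\theta)(1+\kappa\theta)},$$ and suppose that this ratio is nonzero at every integer $n\ge0$, so that $\mathcal H_\theta$ is invertible. Let $$\tilde{\mathrm C}_2\cdot x^n=\prod_{k=0}^{n-1}(x+\ell_k),\qquad \ell_k=\frac{2ah\lambda^2}{\kappa}(1+k)(1+\beta k),\qquad \mathrm G_{\mathcal W}=\tilde{\mathrm C}_2\,\mathcal H_\theta^{-1}\,\mathrm C_{f/f'}^{-1}f'(\mathrm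 D)^{-1/\lambda}\mathrm C_f\,\mathcal H_\theta .$$ **Theorem.** 1. (Jacobi building blocks.) Let $\gamma\in\mathbb C$ with $1+\gamma n\ne0$ for all $n\ge0$, let $\mathcal F_0=1$, $\mathcal F_{\theta+1}/\mathcal F_\theta=(1+\gamma\theta)(1+\lambda\theta)^{-1}(1+\kappa\theta)^{-1}$, and let $\mathrm G_{\mathcal Q}=\mathcal F_\theta^{-1}\mathrm K\mathcal F_\theta$ be the Jacobi operator with parameter $\gamma$. Then $\mathrm G_{\mathcal Q}\cdot x^n$ is a monic family, $\mathcal F_\theta\,(\mathrm G_{\mathcal Q}^{-1}x\,\mathrm G_{\mathcal Q})\,\mathcal F_\theta^{-1}=\mathcal J_\gamma$, and its differential operator is $$\mathrm G_{\mathcal Q}(1+\lambda\theta)^2\mathrm G_{\mathcal Q}^{-1}=(1+\lambda\theta)^2-\frac{2a\lambda^2}{\kappa}(1+\gamma\theta)\mathrm D .$$ 2. $\mathrm G_{\mathcal W}$ is the operator of a monic family, and among operators $\mathrm G$ of monic families it is the only one for which $\mathcal H_\theta(\mathrm G^{-1}x\,\mathrm G)\mathcal H_\theta^{-1}$ is the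 affine combination of the multiplied Jacobi operator with parameter $\beta$ and the ordinary Jacobi operator with parameter $\widetilde\beta$: $$\mathcal H_\theta\,(\mathrm G_{\mathcal W}^{-1}x\,\mathrm G_{\mathcal W})\,\mathcal H_\theta^{-1}=h\,(1+\lambda\theta)^2\mathcal J_\beta+(1-h)\,\mathcal J_{\widetilde\beta}.$$ 3. Put $$A^{(s)}_n=sa+(1-s)\frac a2\Big(\frac{2+\lambda n}{1+\kappa n}+\frac{\lambda n}{1+\kappa(n-1)}\Big),\qquad E^{(s)}_n=\frac{\lambda a^2}{4}(2+\lambda n)\Big(\frac{s}{1+\lambda(n+1)}+\frac{1-s}{1+\kappa n}\Big)$$ (the second fraction in $A^{(s)}_n$ being $0$ for $n=0$). Then $\mathrm G_{\mathcal W}^{-1}x\,\mathrm G_{\mathcal W}=x+a_\theta+b_{\theta+1}\mathrm D=x+a_\theta+\mathrm D\,b_\theta$, where for $n\ge0$ $$a_n=h(1+\lambda n)^2A^{(r)}_n+(1-h)A^{(\widetilde r)}_n,\qquad b_{n+1}=\Big(h(1+\lambda n)^2E^{(r)}_n+(1-h)E^{(\widetilde r)}_n\Big)\frac{\mathcal H_{n+1}}{\mathcal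 H_n}.$$ 4. The family $\mathrm G_{\mathcal W}\cdot x^n$ is orthogonal if and only if $a\ne0$ and, for all $n\ge0$, $$h(1+\lambda n)^2\big(r(1+\kappa n)+(1-r)(1+\lambda(n+1))\big)+(1-h)\big(\widetilde r(1+\kappa n)+(1-\widetilde r)(1+\lambda(n+1))\big)\neq0 .$$ In all cases the polynomials $p_n=\mathrm G_{\mathcal W}\cdot x^n$ satisfy $\langle p_m,p_n\rangle=0$ for $m\ne n$ and $\langle p_n,p_n\rangle=n!\,b_1\cdots b_n$, where $\langle p,q\rangle=\big(\mathrm G_{\mathcal W}^{-1}\cdot pq\big)(0)$. 5. $\tilde{\mathrm C}_2$ is the unique invertible operator with $\tilde{\mathrm C}_2\cdot1=1$ and $\tilde{\mathrm C}_2^{-1}x\,\tilde{\mathrm C}_2=x-\ell_\theta$, where $\ell_\theta=\frac{2ah\lambda^2}{\kappa}(1+\theta)(1+\beta\theta)$. -/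

import Mathlib

open Polynomial

noncomputable section

namespace UmbralWilson

/-! ### Operators on polynomials and families of polynomials -/

/-- Multiplication by `x` on `ℂ[x]`. -/
def mulX : Module.End ℂ ℂ[X] := LinearMap.mulLeft ℂ (X : ℂ[X])

/-- The derivative `D = d/dx` on `ℂ[x]`. -/
def opD : Module.End ℂ ℂ[X] := Polynomial.derivative

/-- The diagonal operator `s_θ`, which sends `x ^ n` to `s n • x ^ n`. -/
def diag (s : ℕ → ℂ) : Module.End ℂ ℂ[X] :=
  (basisMonomials ℂ).constr ℂ (fun n => s n • (X : ℂ[X]) ^ n)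

theorem basisMonomials_eq (n : ℕ) : basisMonomials ℂ n = (X : ℂ[X]) ^ n := by
  simp [coe_basisMonomials, monomial_one_right_eq_X_pow]

theorem diag_X_pow (s : ℕ → ℂ) (n : ℕ) : diag s (X ^ n) = s n • (X : ℂ[X]) ^ n := by
  rw [← basisMonomials_eq, diag, Module.Basis.constr_basis, basisMonomials_eq]

theorem diag_comp (s t : ℕ → ℂ) (h : ∀ n, s n * t n = 1) :
    diag s ∘ₗ diag t = LinearMap.id := by
  refine (basisMonomials ℂ).ext fun n => ?_
  rw [basisMonomials_eq, LinearMap.comp_apply, diag_X_pow, map_smul, diag_X_pow, smul_smul,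
    mul_comm, h, one_smul, LinearMap.id_apply]

/-- The diagonal operator of a sequence without zeros, as an invertible operator. -/
def diagEquiv (s : ℕ → ℂ) (hs : ∀ n, s n ≠ 0) : ℂ[X] ≃ₗ[ℂ] ℂ[X] :=
  LinearEquiv.ofLinearMap (diag s) (diag fun n => (s n)⁻¹)
    (diag_comp _ _ fun n => mul_inv_cancel₀ (hs n))
    (diag_comp _ _ fun n => inv_mul_cancel₀ (hs n))

/-- The sequence `ρ 0 * ρ 1 * ⋯ * ρ (n - 1)`: it is the sequence `H` with `H 0 = 1` and
`H (n + 1) / H n = ρ n`. -/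
def prodSeq (ρ : ℕ → ℂ) (n : ℕ) : ℂ := ∏ k ∈ Finset.range n, ρ k

theorem prodSeq_ne_zero (ρ : ℕ → ℂ) (hρ : ∀ n, ρ n ≠ 0) (n : ℕ) : prodSeq ρ n ≠ 0 :=
  Finset.prod_ne_zero_iff.mpr fun k _ => hρ k

/-- The invertible diagonal operator `H_θ` with `H 0 = 1` and `H_{θ+1} / H_θ = ρ_θ`. -/
def ratioDiag (ρ : ℕ → ℂ) (hρ : ∀ n, ρ n ≠ 0) : ℂ[X] ≃ₗ[ℂ] ℂ[X] :=
  diagEquiv (prodSeq ρ) (prodSeq_ne_zero ρ hρ)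

/-- The invertible operator that sends `x ^ n` to `q n`, for polynomials `q n` of exact degree
`n`. -/
def familyOp (q : ℕ → ℂ[X]) (hd : ∀ n, (q n).natDegree ≤ n) (hc : ∀ n, (q n).coeff n ≠ 0) :
    ℂ[X] ≃ₗ[ℂ] ℂ[X] :=
  let S : Polynomial.Sequence ℂ :=
    { elems' := q
      degree_eq' := fun n =>
        degree_eq_of_le_of_coeff_ne_zero (natDegree_le_iff_degree_le.mp (hd n)) (hc n) }
  (basisMonomials ℂ).equiv
    (S.basis fun n => (leadingCoeff_ne_zero.mpr (S.ne_zero n)).isUnit) (Equiv.refl ℕ)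

theorem familyOp_X_pow (q : ℕ → ℂ[X]) (hd : ∀ n, (q n).natDegree ≤ n)
    (hc : ∀ n, (q n).coeff n ≠ 0) (n : ℕ) : familyOp q hd hc (X ^ n) = q n := by
  rw [← basisMonomials_eq, familyOp, Module.Basis.equiv_apply, Polynomial.Sequence.basis_eq_self]
  rfl

/-- `G` is the operator `x ^ n ↦ p n` of a family of monic polynomials `p n` of degree `n`. -/
def IsMonicFamily (G : ℂ[X] ≃ₗ[ℂ] ℂ[X]) : Prop :=
  ∀ n : ℕ, (G (X ^ n)).Monic ∧ (G (X ^ n)).natDegree = n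

/-- The dual raising operator `G⁻¹ x G` of the family `G (x ^ n)`. -/
def dualRaising (G : ℂ[X] ≃ₗ[ℂ] ℂ[X]) : Module.End ℂ ℂ[X] :=
  LinearEquiv.conj G⁻¹ mulX

/-- The family `G (x ^ n)` is a family of (general) orthogonal polynomials: it is monic, and its
dual raising operator has the three-term form `x + a_θ + D b_θ` with all `b n ≠ 0`. -/
def IsOrthogonalFamily (G : ℂ[X] ≃ₗ[ℂ] ℂ[X]) : Prop :=
  IsMonicFamily G ∧ ∃ a b : ℕ → ℂ, (∀ n, b n ≠ 0) ∧
    dualRaising G = mulX + diag a + opD * diag b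

/-- The moment functional `p ↦ f₀(D) p |_{x=0}` of the family, where
`f₀(y) = ∑ (y ^ n / n!) (G⁻¹ x ^ n)(0)`; in other words `p ↦ (G⁻¹ p)(0)`. -/
def moment (G : ℂ[X] ≃ₗ[ℂ] ℂ[X]) (p : ℂ[X]) : ℂ := (G⁻¹ p).eval 0

/-! ### Operators attached to power series -/

theorem natDegree_iterate_X_pow_le (n k : ℕ) :
    (derivative^[k] ((X : ℂ[X]) ^ n)).natDegree ≤ n - k := by
  simpa using natDegree_iterate_derivative ((X : ℂ[X]) ^ n) k

/-- The operator `g(D) = ∑ g_k D ^ k` for a power series `g` with nonzero constant term. -/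
def seriesD (g : PowerSeries ℂ) (hg : PowerSeries.constantCoeff g ≠ 0) : ℂ[X] ≃ₗ[ℂ] ℂ[X] :=
  familyOp
    (fun n => ∑ k ∈ Finset.range (n + 1), PowerSeries.coeff k g • derivative^[k] ((X : ℂ[X]) ^ n))
    (fun n => natDegree_sum_le_of_forall_le _ _ fun k _ =>
      (natDegree_smul_le _ _).trans ((natDegree_iterate_X_pow_le n k).trans (Nat.sub_le _ _)))
    (fun n => by
      rw [finsetSum_coeff, Finset.sum_range_succ', Finset.sum_eq_zero]
      · simpa using hg
      · intro k hk
        have hk' := Finset.mem_range.mp hk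
        rw [coeff_smul, coeff_eq_zero_of_natDegree_lt, smul_zero]
        exact (natDegree_iterate_X_pow_le n (k + 1)).trans_lt (by omega))

/-- The series `g ^ s`, for `g` with constant term `1` and a complex exponent `s`, by the binomial
series `∑ (s choose k) (g - 1) ^ k`. -/
def cpow (g : PowerSeries ℂ) (s : ℂ) : PowerSeries ℂ :=
  (PowerSeries.binomialSeries ℂ s).subst (g - 1)

theorem constantCoeff_cpow (g : PowerSeries ℂ) (s : ℂ) (hg : PowerSeries.constantCoeff g = 1) :
    PowerSeries.constantCoeff (cpow g s) = 1 := by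
  have h0 : PowerSeries.constantCoeff (g - 1) = 0 := by simp [hg]
  have hs : PowerSeries.HasSubst (g - 1) := PowerSeries.HasSubst.of_constantCoeff_zero' h0
  have h1 : PowerSeries.constantCoeff
      ((PowerSeries.binomialSeries ℂ s - 1).subst (g - 1) : PowerSeries ℂ) = 0 :=
    PowerSeries.constantCoeff_subst_eq_zero h0 _ (by simp)
  have h2 : cpow g s = (PowerSeries.binomialSeries ℂ s - 1).subst (g - 1) + 1 := by
    have h3 : (PowerSeries.subst (g - 1) (1 : PowerSeries ℂ) : PowerSeries ℂ) = 1 := by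
      rw [← PowerSeries.coe_substAlgHom hs, map_one]
    rw [cpow, ← sub_add_cancel (PowerSeries.binomialSeries ℂ s) 1, PowerSeries.subst_add hs, h3,
      sub_add_cancel]
  rw [h2, map_add, h1, zero_add, map_one]

/-- `f ∈ y + y ^ 2 ℂ[[y]]`. -/
def IsDelta (f : PowerSeries ℂ) : Prop :=
  PowerSeries.constantCoeff f = 0 ∧ PowerSeries.coeff 1 f = 1

theorem IsDelta.coeff_pow_self {f : PowerSeries ℂ} (hf : IsDelta f) (n : ℕ) :
    PowerSeries.coeff n (f ^ n) = 1 := by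
  obtain ⟨g, rfl⟩ := PowerSeries.X_dvd_iff.mpr hf.1
  have hg : PowerSeries.constantCoeff g = 1 := by
    have := hf.2
    rwa [← zero_add 1, PowerSeries.coeff_succ_X_mul, PowerSeries.coeff_zero_eq_constantCoeff_apply]
      at this
  have := PowerSeries.coeff_X_pow_mul (g ^ n) n 0
  rw [zero_add] at this
  rw [mul_pow, this, PowerSeries.coeff_zero_eq_constantCoeff_apply, map_pow, hg, one_pow]

/-- The polynomial `∑_k (n! / k!) ([y ^ n] f ^ k) x ^ k`. -/
def dualBinomialPoly (f : PowerSeries ℂ) (n : ℕ) : ℂ[X] :=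
  ∑ k ∈ Finset.range (n + 1),
    ((n.factorial : ℂ) / (k.factorial : ℂ) * PowerSeries.coeff n (f ^ k)) • (X : ℂ[X]) ^ k

/-- The operator `C_f` with `C_f (x ^ n) = p n`, where `p` is the family of binomial type given by
`e ^ (x y) = ∑ p n f(y) ^ n / n!`. Comparing the coefficients of `y ^ n / n!`, this says that
`x ^ n = ∑_k (n! / k!) ([y ^ n] f ^ k) p k = C_f (∑_k (n! / k!) ([y ^ n] f ^ k) x ^ k)`. -/
def umbral (f : PowerSeries ℂ) (hf : IsDelta f) : ℂ[X] ≃ₗ[ℂ] ℂ[X] :=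
  (familyOp (dualBinomialPoly f)
    (fun n => natDegree_sum_le_of_forall_le _ _ fun k hk =>
      (natDegree_smul_le _ _).trans (by
        have := Finset.mem_range.mp hk
        rw [natDegree_X_pow]; omega))
    (fun n => by
      rw [dualBinomialPoly, finsetSum_coeff, Finset.sum_range_succ, Finset.sum_eq_zero]
      · simp [hf.coeff_pow_self, Nat.factorial_ne_zero]
      · intro k hk
        have := Finset.mem_range.mp hk
        simp [coeff_X_pow, this.ne']))⁻¹

/-- The transform `𝔗f = f / f'`. -/
def frakT (f : PowerSeries ℂ) : PowerSeries ℂ := f * (PowerSeries.derivative ℂ f)⁻¹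

theorem IsDelta.constantCoeff_derivative {f : PowerSeries ℂ} (hf : IsDelta f) :
    PowerSeries.constantCoeff (PowerSeries.derivative ℂ f) = 1 := by
  rw [← PowerSeries.coeff_zero_eq_constantCoeff_apply, PowerSeries.coeff_derivative]
  simp [hf.2]

theorem IsDelta.frakT {f : PowerSeries ℂ} (hf : IsDelta f) : IsDelta (frakT f) := by
  obtain ⟨g, hg⟩ := PowerSeries.X_dvd_iff.mpr hf.1
  have hg1 : PowerSeries.constantCoeff g = 1 := by
    have := hf.2
    rwa [hg, ← zero_add 1, PowerSeries.coeff_succ_X_mul,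
      PowerSeries.coeff_zero_eq_constantCoeff_apply] at this
  constructor
  · rw [UmbralWilson.frakT, map_mul, hf.1, zero_mul]
  · have h : UmbralWilson.frakT f
        = PowerSeries.X * (g * (PowerSeries.derivative ℂ f)⁻¹) := by
      rw [UmbralWilson.frakT, ← mul_assoc, ← hg]
    rw [h, ← zero_add 1, PowerSeries.coeff_succ_X_mul,
      PowerSeries.coeff_zero_eq_constantCoeff_apply, map_mul, hg1,
      PowerSeries.constantCoeff_inv, hf.constantCoeff_derivative]
    simp

/-! ### The Jacobi and Wilson families -/

/-- The series `f(y) = y / (1 - (λ a / 2) y)`. -/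
def serF (lam a : ℂ) : PowerSeries ℂ :=
  PowerSeries.X * (1 - PowerSeries.C (lam * a / 2) * PowerSeries.X)⁻¹

theorem isDelta_serF (lam a : ℂ) : IsDelta (serF lam a) := by
  constructor
  · simp [serF]
  · rw [serF, ← zero_add 1, PowerSeries.coeff_succ_X_mul,
      PowerSeries.coeff_zero_eq_constantCoeff_apply, PowerSeries.constantCoeff_inv]
    simp

/-- The operator `f'(D) ^ s`. -/
def derivPow (lam a s : ℂ) : ℂ[X] ≃ₗ[ℂ] ℂ[X] :=
  seriesD (cpow (PowerSeries.derivative ℂ (serF lam a)) s) (by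
    rw [constantCoeff_cpow _ _ (isDelta_serF lam a).constantCoeff_derivative]
    exact one_ne_zero)

/-- The operator `C_f`. -/
def opCf (lam a : ℂ) : ℂ[X] ≃ₗ[ℂ] ℂ[X] := umbral (serF lam a) (isDelta_serF lam a)

/-- The operator `C_{f/f'}`. -/
def opCTf (lam a : ℂ) : ℂ[X] ≃ₗ[ℂ] ℂ[X] :=
  umbral (frakT (serF lam a)) (isDelta_serF lam a).frakT

/-- The ratio `F_{n+1} / F_n` of the Jacobi family with parameter `β`. -/
def jacobiRatio (lam kap β : ℂ) (n : ℕ) : ℂ :=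
  (1 + β * n) / ((1 + lam * n) * (1 + kap * n))

/-- The operator `F_θ⁻¹ C_{f/f'}⁻¹ f'(D) ^ (-1/λ) C_f F_θ` of the Jacobi family with
parameter `β`. -/
def jacobiG (lam kap a β : ℂ) (hF : ∀ n, jacobiRatio lam kap β n ≠ 0) : ℂ[X] ≃ₗ[ℂ] ℂ[X] :=
  (ratioDiag (jacobiRatio lam kap β) hF)⁻¹ * (opCTf lam a)⁻¹ * derivPow lam a (-1 / lam) *
    opCf lam a * ratioDiag (jacobiRatio lam kap β) hF

/-- The Jacobi operator
`C_f⁻¹ f'(D) ^ (1/λ) C_{f/f'} [x (1 + βθ) / ((1 + λθ)(1 + κθ))] C_{f/f'}⁻¹ f'(D) ^ (-1/λ) C_f`. -/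
def jacobiOp (lam kap a β : ℂ) : Module.End ℂ ℂ[X] :=
  LinearEquiv.conj ((opCTf lam a)⁻¹ * derivPow lam a (-1 / lam) * opCf lam a)⁻¹
    (mulX * diag (jacobiRatio lam kap β))

/-- The ratio `H_{n+1} / H_n` of the Wilson family. -/
def wilsonRatio (lam kap β β' h : ℂ) (n : ℕ) : ℂ :=
  (h * (1 + β * n) * (1 + lam * (n + 1)) ^ 2 + (1 - h) * (1 + β' * n)) /
    ((1 + lam * n) * (1 + kap * n))

/-- The operator with `x ^ n ↦ ∏_{k < n} (x + ℓ k)`. -/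
def shiftedOp (l : ℕ → ℂ) : ℂ[X] ≃ₗ[ℂ] ℂ[X] :=
  familyOp (fun n => ∏ k ∈ Finset.range n, (X + C (l k)))
    (fun n => by
      rw [natDegree_prod_of_monic _ _ fun k _ => monic_X_add_C (l k)]
      simp)
    (fun n => by
      have hm : (∏ k ∈ Finset.range n, ((X : ℂ[X]) + C (l k))).Monic :=
        monic_prod_of_monic _ _ fun k _ => monic_X_add_C (l k)
      have hn : (∏ k ∈ Finset.range n, ((X : ℂ[X]) + C (l k))).natDegree = n := by
        rw [natDegree_prod_of_monic _ _ fun k _ => monic_X_add_C (l k)]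
        simp
      have h1 := hm.coeff_natDegree
      rw [hn] at h1
      rw [h1]
      exact one_ne_zero)

/-- The sequence `ℓ_k = (2 a h λ² / κ) (1 + k) (1 + β k)`. -/
def wilsonShift (lam kap a β h : ℂ) (k : ℕ) : ℂ :=
  2 * a * h * lam ^ 2 / kap * (1 + k) * (1 + β * k)

/-- The operator `G_W = C̃₂ H_θ⁻¹ C_{f/f'}⁻¹ f'(D) ^ (-1/λ) C_f H_θ`. -/
def wilsonG (lam kap a β β' h : ℂ) (hH : ∀ n, wilsonRatio lam kap β β' h n ≠ 0) :
    ℂ[X] ≃ₗ[ℂ] ℂ[X] :=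
  shiftedOp (wilsonShift lam kap a β h) * (ratioDiag (wilsonRatio lam kap β β' h) hH)⁻¹ *
    (opCTf lam a)⁻¹ * derivPow lam a (-1 / lam) * opCf lam a *
    ratioDiag (wilsonRatio lam kap β β' h) hH

/-- The diagonal coefficient of the Jacobi operator with parameter `β = r κ + (1 - r) λ`. -/
def jacobiDiagCoeff (lam kap a r : ℂ) (n : ℕ) : ℂ :=
  r * a + (1 - r) *
    (a / 2 * (2 + lam * n) / (1 + kap * n) + a / 2 * (lam * n) / (1 + kap * (n - 1)))

/-- The lowering coefficient (the factor in front of `D`) of the Jacobi operator with parameter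
`β = r κ + (1 - r) λ`. -/
def jacobiLowerCoeff (lam kap a r : ℂ) (n : ℕ) : ℂ :=
  lam * a ^ 2 / 4 * (2 + lam * n) * (r / (1 + lam * (n + 1)) + (1 - r) / (1 + kap * n))

/-- The coefficient `a_n` of the Wilson family, for `β = r κ + (1 - r) λ` and
`β' = r' κ + (1 - r') λ`. -/
def wilsonA (lam kap a r r' h : ℂ) (n : ℕ) : ℂ :=
  h * (1 + lam * n) ^ 2 * jacobiDiagCoeff lam kap a r n
    + (1 - h) * jacobiDiagCoeff lam kap a r' n

/-- The coefficient `b_{n+1}` of the Wilson family, for `β = r κ + (1 - r) λ` and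
`β' = r' κ + (1 - r') λ`. -/
def wilsonB (lam kap a r r' h : ℂ) (n : ℕ) : ℂ :=
  (h * (1 + lam * n) ^ 2 * jacobiLowerCoeff lam kap a r n
    + (1 - h) * jacobiLowerCoeff lam kap a r' n) *
  wilsonRatio lam kap (r * kap + (1 - r) * lam) (r' * kap + (1 - r') * lam) h n

end UmbralWilson

end

open UmbralWilson

noncomputable section

namespace UmbralWilson

/-! ### Diagonal, raising and lowering operators -/

/-! An operator `A` is encoded by the series `φ m` in `A e^{xy} = ∑ φ m (y) x ^ m / m!`. Factors on
the right act on `φ m` as differential operators in `y`; factors on the left act on the index `m`.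
With `c = λa/2`, the operator `K = C_{f/f'}⁻¹ f'(D)^(-1/λ) C_f` has the symbol `v u ^ m`, where `u =
y/(1 + cy)²` and `v = (1 + cy)^(-2/λ)`. The differential equations of `u` and `v` become
intertwining relations for `K`.

Two of them express `θK(1 - cD)` and `xK(1 - cD)` as `K` times explicit differential operators. They
determine `K⁻¹ x (1 + μθ)⁻¹ K` for `μ = λ` and `μ = κ`: a three-term ansatz is checked coefficient
by coefficient (`mulX_diag_mul_kernelOp`). Every Jacobi operator is an affine combination of these
two, by partial fractions in `n` (`jacobiOp_three_term`).

The third relation is `K(1 + λθ)² = ((1 + λθ)² - (2aλ²/κ)(1 + λθ)(1 + κθ)D)K` (`kernelOp_mul_sq`).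
It gives the Jacobi differential operator. It also moves the multiplier `(1 + λθ)²` through `K⁻¹`:
the main term changes the ratio of the raising operator, and in the correction `D` meets `x` and
leaves only a diagonal operator, `ℓ_θ`. Since `C̃₂⁻¹ x C̃₂ = x - ℓ_θ`, the operator `C̃₂` produces
exactly this correction (`conj_dualRaising_wilsonG`).

Uniqueness holds because `G⁻¹ x ^ (n+1)` arises from `G⁻¹ x ^ n` by the dual raising operator.
Orthogonality and the norms follow from the three-term recurrence by induction. -/

theorem mulX_X_pow (n : ℕ) : mulX (X ^ n) = (X : ℂ[X]) ^ (n + 1) := by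
  rw [mulX, LinearMap.mulLeft_apply, pow_succ']

theorem opD_X_pow (n : ℕ) : opD (X ^ n) = (n : ℂ) • (X : ℂ[X]) ^ (n - 1) := by
  rw [opD, derivative_X_pow, smul_eq_C_mul]

theorem opD_X_pow_succ (n : ℕ) : opD (X ^ (n + 1)) = ((n : ℂ) + 1) • (X : ℂ[X]) ^ n := by
  rw [opD_X_pow]; simp

theorem opD_one_poly : opD 1 = 0 := derivative_one

theorem diag_one_poly (s : ℕ → ℂ) : diag s 1 = s 0 • (1 : ℂ[X]) := by
  simpa using diag_X_pow s 0

theorem end_ext {A B : Module.End ℂ ℂ[X]} (h : ∀ n : ℕ, A (X ^ n) = B (X ^ n)) : A = B :=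
  (basisMonomials ℂ).ext fun n => by rw [basisMonomials_eq, h]

theorem equiv_ext {A B : ℂ[X] ≃ₗ[ℂ] ℂ[X]} (h : ∀ n : ℕ, A (X ^ n) = B (X ^ n)) : A = B :=
  LinearEquiv.toLinearMap_injective (end_ext h)

theorem diag_add (s t : ℕ → ℂ) : diag (fun n => s n + t n) = diag s + diag t :=
  end_ext fun n => by simp [diag_X_pow, add_smul]

theorem diag_const_mul (z : ℂ) (s : ℕ → ℂ) : diag (fun n => z * s n) = z • diag s :=
  end_ext fun n => by simp [diag_X_pow, mul_smul]

theorem diag_one : diag (fun _ => 1) = 1 := end_ext fun n => by simp [diag_X_pow]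

theorem diag_mul_diag (s t : ℕ → ℂ) : diag s * diag t = diag fun n => s n * t n :=
  end_ext fun n => by simp [diag_X_pow, smul_smul, mul_comm]

theorem diag_mul_mulX (s : ℕ → ℂ) : diag s * mulX = mulX * diag fun n => s (n + 1) :=
  end_ext fun n => by simp [diag_X_pow, mulX_X_pow]

theorem opD_mul_diag (s : ℕ → ℂ) : opD * diag s = diag (fun n => s (n + 1)) * opD :=
  end_ext fun n => by
    cases n with
    | zero => simp [diag_one_poly, opD_one_poly]
    | succ n => simp [diag_X_pow, opD_X_pow_succ, smul_smul, mul_comm]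

theorem opD_mul_mulX (s : ℕ → ℂ) :
    opD * (mulX * diag s) = diag fun n => ((n : ℂ) + 1) * s n :=
  end_ext fun n => by simp [diag_X_pow, mulX_X_pow, opD_X_pow_succ, smul_smul, mul_comm]

theorem mulX_mul_opD : mulX * opD = diag fun n => (n : ℂ) :=
  end_ext fun n => by
    cases n with
    | zero => simp [diag_one_poly, opD_one_poly]
    | succ n => simp [diag_X_pow, mulX_X_pow, opD_X_pow_succ]

/-- The value on `x ^ n` of an operator of three-term form. -/
theorem three_term_X_pow (s₀ s₁ s₂ : ℕ → ℂ) (n : ℕ) :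
    (mulX * diag s₀ + diag s₁ + diag s₂ * opD) (X ^ n) =
      s₀ n • (X : ℂ[X]) ^ (n + 1) + s₁ n • X ^ n + ((n : ℂ) * s₂ (n - 1)) • X ^ (n - 1) := by
  simp [diag_X_pow, mulX_X_pow, opD_X_pow, smul_smul]

/-- An operator `diag s + diag t * D` with `s` without zeros is right cancellable. -/
theorem mul_right_cancel_triangular {A B : Module.End ℂ ℂ[X]} (s t : ℕ → ℂ) (hs : ∀ n, s n ≠ 0)
    (h : A * (diag s + diag t * opD) = B * (diag s + diag t * opD)) : A = B := by
  refine end_ext fun n => ?_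
  induction n with
  | zero =>
    have h0 := LinearMap.congr_fun h (X ^ 0)
    simp only [Module.End.mul_apply, LinearMap.add_apply, diag_X_pow, opD_X_pow, Nat.cast_zero,
      zero_smul, map_zero, add_zero, map_smul] at h0
    exact smul_right_injective _ (hs 0) h0
  | succ n ih =>
    have h0 := LinearMap.congr_fun h (X ^ (n + 1))
    -- The `D` part lands on `x ^ n`, where `A` and `B` agree by induction; what remains is a
    -- multiple of `x ^ (n+1)` by a nonzero scalar.
    simp only [Module.End.mul_apply, LinearMap.add_apply, diag_X_pow, opD_X_pow_succ, map_add,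
      map_smul, ih, add_left_inj] at h0
    exact smul_right_injective _ (hs (n + 1)) h0

/-! ### Conjugation -/

/-- The underlying endomorphism of an invertible operator. -/
abbrev toEnd (e : ℂ[X] ≃ₗ[ℂ] ℂ[X]) : Module.End ℂ ℂ[X] := e.toLinearMap

theorem conj_eq_iff (e : ℂ[X] ≃ₗ[ℂ] ℂ[X]) (A B : Module.End ℂ ℂ[X]) :
    LinearEquiv.conj e A = B ↔ toEnd e * A = B * toEnd e := by
  constructor
  · rintro rfl
    ext1 n; simp [LinearEquiv.conj_apply, toEnd, LinearMap.ext_iff]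
  · intro h
    refine LinearMap.ext fun p => ?_
    have := LinearMap.congr_fun h (e.symm p)
    simpa using this

theorem conj_inv_eq_iff (e : ℂ[X] ≃ₗ[ℂ] ℂ[X]) (A B : Module.End ℂ ℂ[X]) :
    LinearEquiv.conj e⁻¹ A = B ↔ A * toEnd e = toEnd e * B := by
  have h : LinearEquiv.conj e⁻¹ A = B ↔ A = LinearEquiv.conj e B := by
    change LinearEquiv.conj e.symm A = B ↔ _
    constructor
    · rintro rfl; rw [LinearEquiv.conj_conj_symm]
    · rintro rfl; rw [LinearEquiv.conj_symm_conj]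
  rw [h, eq_comm, conj_eq_iff, eq_comm]

theorem conj_mul_equiv (e e' : ℂ[X] ≃ₗ[ℂ] ℂ[X]) (A : Module.End ℂ ℂ[X]) :
    LinearEquiv.conj (e * e') A = LinearEquiv.conj e (LinearEquiv.conj e' A) := rfl

theorem conj_mul_end (e : ℂ[X] ≃ₗ[ℂ] ℂ[X]) (A B : Module.End ℂ ℂ[X]) :
    LinearEquiv.conj e (A * B) = LinearEquiv.conj e A * LinearEquiv.conj e B :=
  LinearEquiv.conj_comp e B A

theorem toEnd_ratioDiag (ρ : ℕ → ℂ) (hρ : ∀ n, ρ n ≠ 0) :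
    toEnd (ratioDiag ρ hρ) = diag (prodSeq ρ) := rfl

theorem conj_ratioDiag_mulX (ρ : ℕ → ℂ) (hρ : ∀ n, ρ n ≠ 0) :
    LinearEquiv.conj (ratioDiag ρ hρ) mulX = mulX * diag ρ := by
  rw [conj_eq_iff, toEnd_ratioDiag, diag_mul_mulX, mul_assoc, diag_mul_diag]
  congr 2; ext n; rw [prodSeq, Finset.prod_range_succ, mul_comm]; rfl

theorem conj_ratioDiag_diag (ρ : ℕ → ℂ) (hρ : ∀ n, ρ n ≠ 0) (s : ℕ → ℂ) :
    LinearEquiv.conj (ratioDiag ρ hρ) (diag s) = diag s := by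
  rw [conj_eq_iff, toEnd_ratioDiag, diag_mul_diag, diag_mul_diag]
  simp only [mul_comm]

theorem conj_ratioDiag_opD (ρ : ℕ → ℂ) (hρ : ∀ n, ρ n ≠ 0) :
    LinearEquiv.conj (ratioDiag ρ hρ) (diag ρ * opD) = opD := by
  rw [conj_eq_iff, toEnd_ratioDiag, opD_mul_diag, ← mul_assoc, diag_mul_diag]
  congr 2; ext n; rw [prodSeq, prodSeq, Finset.prod_range_succ]

/-! ### Symbols of operators -/

/-- The operator `A` has the symbol `φ` if `A e^{xy} = ∑ φ m (y) x ^ m / m!`, that is, if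
`A (x ^ n) = ∑ (n! / m!) [y ^ n] (φ m) x ^ m`. -/
def HasSymbol (A : Module.End ℂ ℂ[X]) (φ : ℕ → PowerSeries ℂ) : Prop :=
  ∀ n m : ℕ, (m.factorial : ℂ) * (A (X ^ n)).coeff m =
    (n.factorial : ℂ) * PowerSeries.coeff n (φ m)

namespace HasSymbol

variable {A B : Module.End ℂ ℂ[X]} {φ ψ : ℕ → PowerSeries ℂ}

theorem unique (hA : HasSymbol A φ) (hB : HasSymbol B φ) : A = B :=
  end_ext fun n => Polynomial.ext fun m =>
    mul_left_cancel₀ (Nat.cast_ne_zero.mpr m.factorial_ne_zero) ((hA n m).trans (hB n m).symm)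

theorem eq (hA : HasSymbol A φ) (hB : HasSymbol B ψ) (h : ∀ m, φ m = ψ m) : A = B :=
  hA.unique ((funext h : φ = ψ) ▸ hB)

theorem congr (hA : HasSymbol A φ) (h : ∀ m, φ m = ψ m) : HasSymbol A ψ :=
  (funext h : φ = ψ) ▸ hA

theorem add (hA : HasSymbol A φ) (hB : HasSymbol B ψ) :
    HasSymbol (A + B) fun m => φ m + ψ m := fun n m => by
  rw [LinearMap.add_apply, coeff_add, mul_add, hA, hB, map_add, mul_add]

theorem smul (hA : HasSymbol A φ) (z : ℂ) :
    HasSymbol (z • A) fun m => PowerSeries.C z * φ m := fun n m => by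
  rw [LinearMap.smul_apply, coeff_smul, smul_eq_mul, PowerSeries.coeff_C_mul, mul_left_comm, hA,
    mul_left_comm]

theorem sub (hA : HasSymbol A φ) (hB : HasSymbol B ψ) :
    HasSymbol (A - B) fun m => φ m - ψ m := fun n m => by
  rw [LinearMap.sub_apply, coeff_sub, mul_sub, hA, hB, map_sub, mul_sub]

/-- The right factor acts on `e^{xy}` first: `D` becomes multiplication by `y` here, and `x` becomes
`d/dy` in the next rule. Left factors act on `x ^ m / m!` and hence on the index. -/
theorem mul_opD (hA : HasSymbol A φ) :
    HasSymbol (A * opD) fun m => PowerSeries.X * φ m := fun n m => by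
  rw [Module.End.mul_apply]
  cases n with
  | zero => rw [opD_X_pow]; simp
  | succ n =>
    rw [opD_X_pow_succ, map_smul, coeff_smul, smul_eq_mul, mul_left_comm, hA,
      PowerSeries.coeff_succ_X_mul, Nat.factorial_succ]
    push_cast; ring

theorem mul_mulX (hA : HasSymbol A φ) :
    HasSymbol (A * mulX) fun m => PowerSeries.derivative ℂ (φ m) := fun n m => by
  rw [Module.End.mul_apply, mulX_X_pow, hA, PowerSeries.coeff_derivative, Nat.factorial_succ]
  push_cast; ring

theorem diag_mul (hA : HasSymbol A φ) (s : ℕ → ℂ) :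
    HasSymbol (diag s * A) fun m => PowerSeries.C (s m) * φ m := fun n m => by
  have key : ∀ p : ℂ[X], (diag s p).coeff m = s m * p.coeff m := fun p => by
    induction p using Polynomial.induction_on' with
    | add p q hp hq => rw [map_add, coeff_add, hp, hq, coeff_add, mul_add]
    | monomial k z =>
      rw [← C_mul_X_pow_eq_monomial, ← smul_eq_C_mul, map_smul, diag_X_pow]
      simp only [coeff_smul, coeff_X_pow, smul_eq_mul]
      split_ifs with h
      · rw [h]; ring
      · simp
  rw [Module.End.mul_apply, key, PowerSeries.coeff_C_mul, mul_left_comm, hA, mul_left_comm]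

theorem opD_mul (hA : HasSymbol A φ) : HasSymbol (opD * A) fun m => φ (m + 1) := fun n m => by
  rw [Module.End.mul_apply, opD, Polynomial.coeff_derivative, ← hA, Nat.factorial_succ]
  push_cast; ring

theorem mulX_mul (hA : HasSymbol A φ) :
    HasSymbol (mulX * A) fun m => (m : PowerSeries ℂ) * φ (m - 1) := fun n m => by
  rw [Module.End.mul_apply, mulX, LinearMap.mulLeft_apply]
  cases m with
  | zero => simp
  | succ m =>
    change _ = (n.factorial : ℂ) *
      PowerSeries.coeff n (((m + 1 : ℕ) : PowerSeries ℂ) * φ m)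
    rw [coeff_X_mul, ← map_natCast (PowerSeries.C (R := ℂ)),
      PowerSeries.coeff_C_mul, mul_left_comm, ← hA, Nat.factorial_succ]
    push_cast; ring

/-- Composition with an operator of Riordan type. -/
theorem mul_riordan {g f : PowerSeries ℂ} (hf : PowerSeries.constantCoeff f = 0)
    (hA : HasSymbol A φ) (hB : HasSymbol B fun m => g * f ^ m) :
    HasSymbol (A * B) fun m => g * (φ m).subst f := fun n m => by
  have hs : PowerSeries.HasSubst f := PowerSeries.HasSubst.of_constantCoeff_zero' hf
  have hz : ∀ (k : ℕ) (q : PowerSeries ℂ), n < k →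
      PowerSeries.coeff n (g * (f ^ k * q)) = 0 := fun k q hk =>
    PowerSeries.X_pow_dvd_iff.mp (((pow_dvd_pow_of_dvd (PowerSeries.X_dvd_iff.mpr hf) k).mul_right
      q).mul_left g) n hk
  have hB0 : (B (X ^ n)).natDegree < n + 1 := by
    rw [Nat.lt_succ_iff, natDegree_le_iff_coeff_eq_zero]
    intro k hk
    have : _ = (n.factorial : ℂ) * PowerSeries.coeff n (g * f ^ k) := hB n k
    rw [← mul_one (f ^ k), hz k 1 hk, mul_zero] at this
    exact (mul_eq_zero.mp this).resolve_left (Nat.cast_ne_zero.mpr k.factorial_ne_zero)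
  have hsplit : PowerSeries.coeff n (g * (φ m).subst f) =
      ∑ k ∈ Finset.range (n + 1),
        PowerSeries.coeff k (φ m) * PowerSeries.coeff n (g * f ^ k) := by
    -- As `f ^ k` has order at least `k`, only the coefficients of `φ m` up to `n` contribute, and
    -- the substitution reduces to a finite sum.
    obtain ⟨q, hq⟩ : PowerSeries.X ^ (n + 1) ∣
        φ m - (PowerSeries.trunc (n + 1) (φ m) : PowerSeries ℂ) := by
      rw [PowerSeries.X_pow_dvd_iff]
      intro k hk
      rw [map_sub, Polynomial.coeff_coe, PowerSeries.coeff_trunc, if_pos hk, sub_self]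
    have h1 : φ m = (PowerSeries.trunc (n + 1) (φ m) : PowerSeries ℂ)
        + PowerSeries.X ^ (n + 1) * q := by rw [← hq]; ring
    conv_lhs => rw [h1]
    rw [PowerSeries.subst_add hs, PowerSeries.subst_mul hs, PowerSeries.subst_pow hs,
      PowerSeries.subst_X hs, mul_add, map_add, hz _ _ (Nat.lt_succ_self n), add_zero,
      PowerSeries.subst_coe hs, PowerSeries.trunc_apply, Finset.range_eq_Ico]
    simp only [map_sum, Finset.mul_sum, aeval_monomial]
    refine Finset.sum_congr rfl fun k _ => ?_
    rw [← Algebra.smul_def, mul_smul_comm, map_smul, smul_eq_mul]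
  rw [Module.End.mul_apply, (B (X ^ n)).as_sum_range' _ hB0, map_sum, finsetSum_coeff, hsplit,
    Finset.mul_sum, Finset.mul_sum]
  refine Finset.sum_congr rfl fun k _ => ?_
  rw [← C_mul_X_pow_eq_monomial, ← smul_eq_C_mul, map_smul, coeff_smul, smul_eq_mul,
    mul_left_comm, hA k m]
  linear_combination PowerSeries.coeff k (φ m) * hB n k

end HasSymbol

theorem hasSymbol_seriesD (g : PowerSeries ℂ) (hg : PowerSeries.constantCoeff g ≠ 0) :
    HasSymbol (toEnd (seriesD g hg)) fun m => g * PowerSeries.X ^ m := fun n m => by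
  rw [toEnd, LinearEquiv.coe_coe, seriesD, familyOp_X_pow, finsetSum_coeff]
  change _ = (n.factorial : ℂ) * PowerSeries.coeff n (g * PowerSeries.X ^ m)
  rw [mul_comm g, PowerSeries.coeff_X_pow_mul']
  simp only [coeff_smul, iterate_derivative_X_pow_eq_smul, coeff_X_pow, smul_eq_mul]
  split_ifs with h
  · rw [Finset.sum_eq_single (n - m)]
    · rw [Nat.sub_sub_self h, if_pos rfl]
      have := Nat.factorial_mul_descFactorial (Nat.sub_le n m)
      rw [Nat.sub_sub_self h] at this
      rw [← this]; push_cast; simp; ring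
    · intro k hk hne
      have := Finset.mem_range.mp hk
      rw [if_neg (by omega)]; simp
    · intro h'; exact absurd (Finset.mem_range.mpr (by omega)) h'
  · rw [Finset.sum_eq_zero]
    · simp
    · intro k hk
      rw [if_neg (by omega)]; simp

/-- The defining expansion of `C_f` reads `C_f⁻¹ e^{xy} = e^{x f(y)}`. -/
theorem hasSymbol_umbral_inv (f : PowerSeries ℂ) (hf : IsDelta f) :
    HasSymbol (toEnd (umbral f hf)⁻¹) fun m => f ^ m := fun n m => by
  have h0 : (umbral f hf)⁻¹ (X ^ n) = dualBinomialPoly f n := by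
    rw [umbral, inv_inv]; exact familyOp_X_pow _ _ _ n
  rw [toEnd, LinearEquiv.coe_coe, h0, dualBinomialPoly, finsetSum_coeff]
  simp only [coeff_smul, coeff_X_pow, smul_eq_mul, mul_ite, mul_one, mul_zero,
    Finset.sum_ite_eq, Finset.mem_range]
  split_ifs with h
  · have := Nat.cast_ne_zero (R := ℂ).mpr m.factorial_ne_zero
    field_simp
  · have hd : PowerSeries.X ^ m ∣ f ^ m := pow_dvd_pow_of_dvd (PowerSeries.X_dvd_iff.mpr hf.1) m
    rw [PowerSeries.X_pow_dvd_iff.mp hd n (by omega), mul_zero]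

/-- If `g ∘ f = y`, then `C_f` has the symbol `g ^ m`. -/
theorem hasSymbol_umbral {f g : PowerSeries ℂ} (hf : IsDelta f) (hg : IsDelta g)
    (hfg : f.subst g = PowerSeries.X) : HasSymbol (toEnd (umbral f hf)) fun m => g ^ m := by
  have h1 : toEnd (umbral f hf)⁻¹ * toEnd (umbral g hg)⁻¹ = 1 := by
    have hs : PowerSeries.HasSubst g := PowerSeries.HasSubst.of_constantCoeff_zero' hg.1
    have h := (hasSymbol_umbral_inv f hf).mul_riordan (g := 1) hg.1
      ((hasSymbol_umbral_inv g hg).congr fun m => (one_mul _).symm)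
    refine (h.congr (ψ := fun m => PowerSeries.X ^ m) fun m => ?_).unique fun n m => ?_
    · rw [PowerSeries.subst_pow hs, hfg, one_mul]
    · simp only [Module.End.one_apply, coeff_X_pow, PowerSeries.coeff_X_pow]
      by_cases hmn : m = n
      · rw [hmn]
      · rw [if_neg hmn, if_neg (Ne.symm hmn), mul_zero, mul_zero]
  have h2 : umbral f hf = (umbral g hg)⁻¹ := by
    rw [← inv_mul_eq_one]
    exact LinearEquiv.toLinearMap_injective h1
  rw [h2]
  exact hasSymbol_umbral_inv g hg

/-! ### The power series of the Jacobi family -/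

theorem derivative_binomialSeries (s : ℂ) :
    (1 + PowerSeries.X) * PowerSeries.derivative ℂ (PowerSeries.binomialSeries ℂ s) =
      PowerSeries.C s * PowerSeries.binomialSeries ℂ s := by
  have hc : ∀ n : ℕ, ((n : ℂ) + 1) * Ring.choose s (n + 1) = (s - n) * Ring.choose s n := by
    intro n
    have h := Ring.choose_eq_smul (a := s) (n := n)
    have h' := Ring.choose_eq_smul (a := s) (n := n + 1)
    rw [h, h', descPochhammer_succ_right, Nat.factorial_succ]
    have := Nat.cast_ne_zero (R := ℂ).mpr n.factorial_ne_zero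
    have h2 : (n : ℂ) + 1 ≠ 0 := n.cast_add_one_ne_zero
    simp [Polynomial.smeval_mul, Polynomial.smeval_sub, Polynomial.smeval_natCast]
    field_simp
  ext n
  rw [add_mul, one_mul, map_add, PowerSeries.coeff_C_mul]
  cases n with
  | zero =>
    have := hc 0
    simp [PowerSeries.coeff_derivative] at this ⊢
  | succ n =>
    have := hc (n + 1)
    rw [PowerSeries.coeff_succ_X_mul, PowerSeries.coeff_derivative, PowerSeries.coeff_derivative]
    simp only [PowerSeries.binomialSeries_coeff, smul_eq_mul, mul_one]
    push_cast at this ⊢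
    linear_combination this

/-- The chain rule applied to the binomial series. This equation and the constant term are all that
is used about the complex power. -/
theorem derivative_cpow (g : PowerSeries ℂ) (s : ℂ) (hg : PowerSeries.constantCoeff g = 1) :
    g * PowerSeries.derivative ℂ (cpow g s) =
      PowerSeries.C s * cpow g s * PowerSeries.derivative ℂ g := by
  have hs : PowerSeries.HasSubst (g - 1) :=
    PowerSeries.HasSubst.of_constantCoeff_zero' (by simp [hg])
  have h := congrArg (PowerSeries.subst (g - 1)) (derivative_binomialSeries s)
  rw [PowerSeries.subst_mul hs, PowerSeries.subst_mul hs, PowerSeries.subst_add hs,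
    PowerSeries.subst_X hs, PowerSeries.subst_C] at h
  have h1 : (PowerSeries.subst (g - 1) (1 : PowerSeries ℂ) : PowerSeries ℂ) = 1 := by
    rw [← PowerSeries.coe_substAlgHom hs, map_one]
  rw [h1, add_sub_cancel] at h
  rw [cpow, PowerSeries.derivative_subst hs, map_sub, Derivation.map_one_eq_zero, sub_zero,
    ← mul_assoc, h]
  rfl

section Series

variable (c : ℂ)

/-- The polynomial `1 + c y`, as a power series. -/
def lin : PowerSeries ℂ := 1 + PowerSeries.C c * PowerSeries.X

theorem constantCoeff_lin : PowerSeries.constantCoeff (lin c) = 1 := by simp [lin]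

theorem lin_ne_zero : lin c ≠ 0 := fun h => by
  simpa [h] using constantCoeff_lin c

theorem lin_mul_inv : lin c * (lin c)⁻¹ = 1 :=
  PowerSeries.mul_inv_cancel _ (by rw [constantCoeff_lin]; exact one_ne_zero)

theorem derivative_lin : PowerSeries.derivative ℂ (lin c) = PowerSeries.C c := by
  simp [lin]

theorem subst_lin {f : PowerSeries ℂ} (hf : PowerSeries.HasSubst f) :
    (lin c).subst f = 1 + PowerSeries.C c * f := by
  have h1 : (PowerSeries.subst f (1 : PowerSeries ℂ) : PowerSeries ℂ) = 1 := by
    rw [← PowerSeries.coe_substAlgHom hf, map_one]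
  rw [lin, PowerSeries.subst_add hf, h1, PowerSeries.subst_mul hf, PowerSeries.subst_C,
    PowerSeries.subst_X hf]
  rfl

/-- The series `y / (1 + c y)`. -/
def mob : PowerSeries ℂ := PowerSeries.X * (lin c)⁻¹

theorem mob_mul_lin : mob c * lin c = PowerSeries.X := by
  rw [mob, mul_assoc, mul_comm _ (lin c), lin_mul_inv, mul_one]

theorem isDelta_mob : IsDelta (mob c) := by
  constructor
  · simp [mob]
  · rw [mob, ← zero_add 1, PowerSeries.coeff_succ_X_mul,
      PowerSeries.coeff_zero_eq_constantCoeff_apply, PowerSeries.constantCoeff_inv,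
      constantCoeff_lin, inv_one]

theorem hasSubst_mob : PowerSeries.HasSubst (mob c) :=
  PowerSeries.HasSubst.of_constantCoeff_zero' (isDelta_mob c).1

theorem derivative_mob : PowerSeries.derivative ℂ (mob c) * lin c ^ 2 = 1 := by
  have h := congrArg (PowerSeries.derivative ℂ) (mob_mul_lin c)
  rw [Derivation.leibniz, PowerSeries.derivative_X, derivative_lin] at h
  simp only [smul_eq_mul] at h
  have h2 := mob_mul_lin c
  have h3 : lin c = 1 + PowerSeries.C c * PowerSeries.X := rfl
  linear_combination lin c * h - PowerSeries.C c * h2 + h3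

theorem lin_neg_subst_mob : (lin (-c)).subst (mob c) * lin c = 1 := by
  rw [subst_lin _ (hasSubst_mob c), map_neg]
  have h2 := mob_mul_lin c
  have h3 : lin c = 1 + PowerSeries.C c * PowerSeries.X := rfl
  linear_combination h3 - PowerSeries.C c * h2

/-- Provides the compositional inverse of `f`, as required for the symbol of `C_f`. -/
theorem mob_neg_subst_mob : (mob (-c)).subst (mob c) = PowerSeries.X := by
  have h := congrArg (PowerSeries.subst (mob c)) (mob_mul_lin (-c))
  rw [PowerSeries.subst_mul (hasSubst_mob c), PowerSeries.subst_X (hasSubst_mob c)] at h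
  have h2 := lin_neg_subst_mob c
  have h3 := mob_mul_lin c
  linear_combination lin c * h + h3 - (mob (-c)).subst (mob c) * h2

end Series

theorem serF_eq_mob (lam a : ℂ) : serF lam a = mob (-(lam * a / 2)) := by
  rw [serF, mob, lin, map_neg, neg_mul, sub_eq_add_neg]

theorem frakT_mob (c : ℂ) : frakT (mob c) = PowerSeries.X * lin c := by
  have h1 := derivative_mob c
  have h2 := mob_mul_lin c
  have h0 : PowerSeries.derivative ℂ (mob c) * (PowerSeries.derivative ℂ (mob c))⁻¹ = 1 :=
    PowerSeries.mul_inv_cancel _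
      (by rw [(isDelta_mob c).constantCoeff_derivative]; exact one_ne_zero)
  have h3 : (PowerSeries.derivative ℂ (mob c))⁻¹ = lin c ^ 2 := by
    linear_combination lin c ^ 2 * h0 - (PowerSeries.derivative ℂ (mob c))⁻¹ * h1
  rw [frakT, h3]
  linear_combination lin c * h2

/-- The series `(1 + c y) ^ (-2/λ)` for `c = λ a / 2`, as `f'(y) ^ (-1/λ)` at the compositional
inverse of `f`. -/
def serV (lam a : ℂ) : PowerSeries ℂ :=
  (cpow (PowerSeries.derivative ℂ (serF lam a)) (-1 / lam)).subst (mob (lam * a / 2))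

/-- The series `y / (1 + c y) ^ 2`. -/
def serU (c : ℂ) : PowerSeries ℂ := (PowerSeries.X * lin (-c)).subst (mob c)

theorem serU_mul (c : ℂ) : serU c * lin c ^ 2 = PowerSeries.X := by
  have hs := hasSubst_mob c
  rw [serU, PowerSeries.subst_mul hs, PowerSeries.subst_X hs]
  have h2 := mob_mul_lin c
  have h1 := lin_neg_subst_mob c
  linear_combination mob c * lin c * h1 + h2

theorem derivative_serU (c : ℂ) :
    PowerSeries.derivative ℂ (serU c) * lin c ^ 3 = lin (-c) := by
  have h := congrArg (PowerSeries.derivative ℂ) (serU_mul c)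
  rw [Derivation.leibniz, PowerSeries.derivative_X, Derivation.leibniz_pow, derivative_lin] at h
  simp only [smul_eq_mul, nsmul_eq_mul, Nat.cast_ofNat] at h
  have h2 := serU_mul c
  have h3 : lin c = 1 + PowerSeries.C c * PowerSeries.X := rfl
  have h4 : lin (-c) = 1 - PowerSeries.C c * PowerSeries.X := by rw [lin, map_neg]; ring
  rw [h4]
  norm_num at h
  linear_combination lin c * h - 2 * PowerSeries.C c * h2 + h3

theorem derivative_serV (lam a : ℂ) (hlam : lam ≠ 0) :
    PowerSeries.derivative ℂ (serV lam a) * lin (lam * a / 2) =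
      - (PowerSeries.C a * serV lam a) := by
  set c := lam * a / 2 with hc
  have hs := hasSubst_mob c
  set g := PowerSeries.derivative ℂ (serF lam a) with hg
  have hg1 : g * lin (-c) ^ 2 = 1 := by rw [hg, serF_eq_mob]; exact derivative_mob _
  have hg2 := congrArg (PowerSeries.derivative ℂ) hg1
  rw [Derivation.leibniz, Derivation.map_one_eq_zero, Derivation.leibniz_pow, derivative_lin]
    at hg2
  simp only [smul_eq_mul, nsmul_eq_mul, Nat.cast_ofNat, Nat.add_one_sub_one, pow_one] at hg2
  have hw := derivative_cpow g (-1 / lam) (isDelta_serF lam a).constantCoeff_derivative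
  set w := cpow g (-1 / lam) with hw'
  -- The logarithmic derivative of `f'` is `2c/(1 - cy)`; multiplied by `-1/λ` it is `-a/(1 - cy)`.
  -- Below, `hode` states this for `w`, and `hode'` transports it along the inverse of `f`.
  have hca : (2 : PowerSeries ℂ) * PowerSeries.C (-1 / lam) * PowerSeries.C (-c) =
      PowerSeries.C a := by
    rw [show (2 : PowerSeries ℂ) = PowerSeries.C (2 : ℂ) from (map_ofNat _ 2).symm, ← map_mul,
      ← map_mul]
    congr 1; rw [hc]; field_simp
  have hode : PowerSeries.derivative ℂ w * lin (-c) = PowerSeries.C (-a) * w := by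
    rw [map_neg]
    linear_combination -(PowerSeries.derivative ℂ w * lin (-c)) * hg1 + lin (-c) ^ 3 * hw +
      PowerSeries.C (-1 / lam) * w * lin (-c) * hg2 -
      2 * PowerSeries.C (-1 / lam) * PowerSeries.C (-c) * w * hg1 - w * hca
  have hode' := congrArg (PowerSeries.subst (mob c)) hode
  rw [PowerSeries.subst_mul hs, PowerSeries.subst_mul hs, PowerSeries.subst_C] at hode'
  change _ = PowerSeries.C (-a) * serV lam a at hode'
  have hv : PowerSeries.derivative ℂ (serV lam a) =
      (PowerSeries.derivative ℂ w).subst (mob c) * PowerSeries.derivative ℂ (mob c) :=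
    PowerSeries.derivative_subst hs
  have h1 := lin_neg_subst_mob c
  have h2 := derivative_mob c
  rw [map_neg] at hode'
  rw [hv]
  linear_combination
    -((PowerSeries.derivative ℂ w).subst (mob c) * PowerSeries.derivative ℂ (mob c) * lin c) * h1 +
    (PowerSeries.derivative ℂ w).subst (mob c) * (lin (-c)).subst (mob c) * h2 + hode'

/-! ### The operator `K` -/

/-- The operator `C_{f/f'}⁻¹ f'(D) ^ (-1/λ) C_f`. -/
def kernelOp (lam a : ℂ) : ℂ[X] ≃ₗ[ℂ] ℂ[X] :=
  (opCTf lam a)⁻¹ * derivPow lam a (-1 / lam) * opCf lam a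

/-- The symbol of the operator `K`. -/
def kernelSymbol (lam a : ℂ) (m : ℕ) : PowerSeries ℂ := serV lam a * serU (lam * a / 2) ^ m

theorem hasSymbol_kernelOp (lam a : ℂ) :
    HasSymbol (toEnd (kernelOp lam a)) (kernelSymbol lam a) := by
  set c := lam * a / 2 with hc
  have hs := hasSubst_mob c
  have hf : HasSymbol (toEnd (opCf lam a)) fun m => mob c ^ m :=
    hasSymbol_umbral (isDelta_serF lam a) (isDelta_mob c)
      (by rw [serF_eq_mob]; exact mob_neg_subst_mob c)
  have ht : HasSymbol (toEnd (opCTf lam a)⁻¹) fun m => frakT (serF lam a) ^ m :=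
    hasSymbol_umbral_inv _ _
  have h1 := ht.mul_riordan (f := PowerSeries.X) (by simp)
    (hasSymbol_seriesD (cpow (PowerSeries.derivative ℂ (serF lam a)) (-1 / lam)) (by
      rw [constantCoeff_cpow _ _ (isDelta_serF lam a).constantCoeff_derivative]
      exact one_ne_zero))
  have h2 := h1.mul_riordan (g := 1) (isDelta_mob c).1 (hf.congr fun m => (one_mul _).symm)
  refine HasSymbol.congr h2 fun m => ?_
  rw [PowerSeries.X_subst, one_mul, PowerSeries.subst_mul hs, PowerSeries.subst_pow hs,
    serF_eq_mob, frakT_mob, ← hc, kernelSymbol, serU, serV, serF_eq_mob]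

section Kernel

variable (lam a : ℂ)

/-- The product rule for `v u ^ m`. The cube of `1 + cy` clears the denominators of `u'` and `v'`,
so that the relation is polynomial in `y` and can be read as one between operators. -/
theorem derivative_kernelSymbol (hlam : lam ≠ 0) (m : ℕ) :
    PowerSeries.derivative ℂ (kernelSymbol lam a m) * lin (lam * a / 2) ^ 3 =
      (m : PowerSeries ℂ) * lin (-(lam * a / 2)) * kernelSymbol lam a (m - 1) -
        PowerSeries.C a * lin (lam * a / 2) ^ 2 * kernelSymbol lam a m := by
  have h1 := derivative_serV lam a hlam
  have h2 := derivative_serU (lam * a / 2)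
  simp only [kernelSymbol, Derivation.leibniz, Derivation.leibniz_pow, smul_eq_mul, nsmul_eq_mul]
  linear_combination serU (lam * a / 2) ^ m * lin (lam * a / 2) ^ 2 * h1 +
    (m : PowerSeries ℂ) * serV lam a * serU (lam * a / 2) ^ (m - 1) * h2

theorem kernelSymbol_succ (m : ℕ) :
    kernelSymbol lam a (m + 1) * lin (lam * a / 2) ^ 2 = PowerSeries.X * kernelSymbol lam a m := by
  have h := serU_mul (lam * a / 2)
  rw [kernelSymbol, kernelSymbol, pow_succ]
  linear_combination serV lam a * serU (lam * a / 2) ^ m * h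

/-- Replacing `y` by `u (1 + cy)²` absorbs the index shift, so that `y d/dy` acts on each symbol
separately. -/
theorem X_mul_derivative_kernelSymbol (hlam : lam ≠ 0) (m : ℕ) :
    PowerSeries.X * PowerSeries.derivative ℂ (kernelSymbol lam a m) * lin (lam * a / 2) =
      ((m : PowerSeries ℂ) * lin (-(lam * a / 2)) - PowerSeries.C a * PowerSeries.X) * kernelSymbol lam a m := by
  have h := derivative_kernelSymbol lam a hlam m
  refine mul_right_cancel₀ (pow_ne_zero 2 (lin_ne_zero (lam * a / 2))) ?_
  cases m with
  | zero => simp at h ⊢; linear_combination PowerSeries.X * h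
  | succ m =>
    have h' := kernelSymbol_succ lam a m
    rw [Nat.add_sub_cancel] at h
    linear_combination PowerSeries.X * h - ((m + 1 : ℕ) : PowerSeries ℂ) *
      lin (-(lam * a / 2)) * h'

/-- The operator `1 + c D`. -/
def linD (c : ℂ) : Module.End ℂ ℂ[X] := 1 + c • opD

theorem HasSymbol.mul_linD {A : Module.End ℂ ℂ[X]} {φ : ℕ → PowerSeries ℂ} (hA : HasSymbol A φ)
    (c : ℂ) : HasSymbol (A * linD c) fun m => lin c * φ m := by
  rw [linD, mul_add, mul_one, mul_smul_comm]
  refine (hA.add (hA.mul_opD.smul c)).congr fun m => ?_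
  rw [lin]; ring

/-! ### Intertwining relations for `K` -/

theorem theta_mul_kernelOp (hlam : lam ≠ 0) :
    mulX * opD * toEnd (kernelOp lam a) * linD (-(lam * a / 2)) =
      toEnd (kernelOp lam a) * (mulX * linD (lam * a / 2) * opD + a • opD) := by
  have hK := hasSymbol_kernelOp lam a
  have hL := (hK.diag_mul fun n => (n : ℂ)).mul_linD (-(lam * a / 2))
  rw [← mulX_mul_opD] at hL
  rw [mul_add, mul_smul_comm, ← mul_assoc, ← mul_assoc]
  refine hL.eq (((hK.mul_mulX.mul_linD _).mul_opD).add (hK.mul_opD.smul a)) fun m => ?_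
  have h := X_mul_derivative_kernelSymbol lam a hlam m
  simp only [map_natCast]
  linear_combination -h

theorem mulX_mul_kernelOp (hlam : lam ≠ 0) :
    mulX * toEnd (kernelOp lam a) * linD (-(lam * a / 2)) =
      toEnd (kernelOp lam a) * (mulX * linD (lam * a / 2) * linD (lam * a / 2) *
        linD (lam * a / 2) + a • (linD (lam * a / 2) * linD (lam * a / 2))) := by
  have hK := hasSymbol_kernelOp lam a
  rw [mul_add, mul_smul_comm, ← mul_assoc, ← mul_assoc, ← mul_assoc, ← mul_assoc]
  refine (hK.mulX_mul.mul_linD _).eq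
    ((((hK.mul_mulX.mul_linD _).mul_linD _).mul_linD _).add
      (((hK.mul_linD _).mul_linD _).smul a)) fun m => ?_
  have h := derivative_kernelSymbol lam a hlam m
  linear_combination -h

/-- On `φ = v u ^ m`, `1 + λ y d/dy` is multiplication by `(1 + λm) q` with `q = (1 - cy)/(1 + cy)`.
In the second application `q² = 1 - 4cu` and `y q' = -2cu`; both corrections carry a factor `u` and
so raise `m` by one, which is the effect of `D` on the left. -/
theorem kernelOp_mul_sq (kap : ℂ) (hlam : lam ≠ 0) (hkap : kap ≠ 0)
    (hlk : 1 / kap - 1 / lam = 1 / 2) :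
    toEnd (kernelOp lam a) * diag (fun n => (1 + lam * n) ^ 2) =
      (diag (fun n => (1 + lam * n) ^ 2) -
        (2 * a * lam ^ 2 / kap) • (diag (fun n => (1 + lam * n) * (1 + kap * n)) * opD)) *
        toEnd (kernelOp lam a) := by
  have hK := hasSymbol_kernelOp lam a
  have hd : diag (fun n => (1 + lam * n) ^ 2) =
      (1 + lam • (mulX * opD)) * (1 + lam • (mulX * opD)) := by
    rw [mulX_mul_opD, ← diag_const_mul, ← diag_one, ← diag_add, diag_mul_diag]
    simp only [sq]
  have h1 := hK.add (hK.mul_mulX.mul_opD.smul lam)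
  have h2 := h1.add (h1.mul_mulX.mul_opD.smul lam)
  have h3 := (hK.diag_mul fun n => (1 + lam * n) ^ 2).sub
    ((hK.opD_mul.diag_mul fun n => (1 + lam * n) * (1 + kap * n)).smul (2 * a * lam ^ 2 / kap))
  have h4 := h2.eq h3 fun m => ?_
  · conv_lhs => rw [hd]
    rw [sub_mul, smul_mul_assoc, mul_assoc (diag _) opD, ← h4]
    simp only [mul_add, add_mul, mul_one, one_mul, mul_smul_comm, smul_mul_assoc, mul_assoc]
  · set c := lam * a / 2 with hc
    set φ := kernelSymbol lam a m with hφ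
    have hL : lin c = 1 + PowerSeries.C c * PowerSeries.X := rfl
    have hq : lin (-c) = 1 - PowerSeries.C c * PowerSeries.X := by rw [lin, map_neg]; ring
    have hc2 : PowerSeries.C lam * PowerSeries.C a = 2 * PowerSeries.C c := by
      rw [show (2 : PowerSeries ℂ) = PowerSeries.C (2 : ℂ) from (map_ofNat _ 2).symm, ← map_mul,
        ← map_mul]
      congr 1; rw [hc]; ring
    have hD := X_mul_derivative_kernelSymbol lam a hlam m
    rw [← hc, ← hφ, hq] at hD
    have hS := kernelSymbol_succ lam a m
    rw [← hc, ← hφ] at hS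
    set ψ := φ + PowerSeries.C lam * (PowerSeries.X * PowerSeries.derivative ℂ φ) with hψ
    have hb : ψ * lin c = (1 + PowerSeries.C lam * (m : PowerSeries ℂ)) * lin (-c) * φ := by
      rw [hψ, hq, hL]
      rw [hL] at hD
      linear_combination PowerSeries.C lam * hD - PowerSeries.X * φ * hc2
    have hb' := congrArg (PowerSeries.derivative ℂ) hb
    simp only [Derivation.leibniz, derivative_lin, smul_eq_mul, map_add,
      Derivation.map_one_eq_zero, PowerSeries.derivative_C, Derivation.map_natCast, map_neg] at hb'
    -- The relation between `κ` and `λ`, as `λ/κ = 1 + λ/2`, turns `4c(1 + λm) + 2cλ` into a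
    -- multiple of `1 + κm`.
    have hco : PowerSeries.C (2 * a * lam ^ 2 / kap) *
        (PowerSeries.C ((1 + lam * m) * (1 + kap * m)) : PowerSeries ℂ) =
        (1 + PowerSeries.C lam * (m : PowerSeries ℂ)) *
          (4 * PowerSeries.C c * (1 + PowerSeries.C lam * (m : PowerSeries ℂ)) +
            2 * PowerSeries.C c * PowerSeries.C lam) := by
      have : 2 * a * lam ^ 2 / kap * ((1 + lam * m) * (1 + kap * m)) =
          (1 + lam * m) * (4 * c * (1 + lam * m) + 2 * c * lam) := by
        have : lam / kap = 1 + lam / 2 := by field_simp at hlk ⊢; linear_combination hlk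
        rw [hc]
        have e : 2 * a * lam ^ 2 / kap * ((1 + lam * m) * (1 + kap * m)) =
          2 * a * lam * (1 + lam * m) * (lam / kap + lam * m) := by field_simp
        rw [e, this]; ring
      rw [← map_mul, this]
      simp only [map_mul, map_add, map_one, map_natCast, map_ofNat]
    have hsq : (PowerSeries.C ((1 + lam * m) ^ 2) : PowerSeries ℂ) =
        (1 + PowerSeries.C lam * (m : PowerSeries ℂ)) ^ 2 := by simp
    rw [← mul_assoc (PowerSeries.C (2 * a * lam ^ 2 / kap)), hco, hsq]
    refine mul_right_cancel₀ (pow_ne_zero 2 (lin_ne_zero c)) ?_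
    rw [hq] at hb hb'
    rw [hL] at hb hb' hD hS ⊢
    generalize (PowerSeries.C c : PowerSeries ℂ) = k at *
    generalize PowerSeries.C lam = l at *
    linear_combination (1 + k * PowerSeries.X) * hb +
      l * PowerSeries.X * (1 + k * PowerSeries.X) * hb' - l * PowerSeries.X * k * hb +
      l * (1 + l * (m : PowerSeries ℂ)) * (1 - k * PowerSeries.X) * hD +
      (1 + l * (m : PowerSeries ℂ)) * (4 * k * (1 + l * (m : PowerSeries ℂ)) + 2 * k * l) * hS -
      (1 + l * (m : PowerSeries ℂ)) * (1 - k * PowerSeries.X) * PowerSeries.X * φ * hc2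

end Kernel

/-! ### The three-term form of the Jacobi operators -/

theorem mulX_mul_diag_mul_opD (s : ℕ → ℂ) :
    mulX * diag s * opD = diag fun n => (n : ℂ) * s (n - 1) :=
  end_ext fun n => by
    cases n with
    | zero => simp [diag_one_poly, opD_one_poly]
    | succ n => simp [diag_X_pow, mulX_X_pow, opD_X_pow_succ, smul_smul]

/-- Normal ordering with `x` on the left and `D` on the right, so that coefficients can be compared.
-/
theorem three_term_mul_triangular (σ A E s t : ℕ → ℂ) :
    (mulX * diag σ + diag A + diag E * opD) * (diag s + diag t * opD) =
      mulX * diag (fun n => σ n * s n) +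
        diag (fun n => A n * s n + n * (σ (n - 1) * t (n - 1))) +
        diag (fun n => A n * t n + E n * s (n + 1)) * opD +
        diag (fun n => E n * t (n + 1)) * opD * opD := by
  have h1 : mulX * diag σ * (diag t * opD) = diag fun n => (n : ℂ) * (σ (n - 1) * t (n - 1)) := by
    rw [← mulX_mul_diag_mul_opD (fun n => σ n * t n), ← diag_mul_diag]; noncomm_ring
  have h2 : diag E * opD * diag s = diag (fun n => E n * s (n + 1)) * opD := by
    rw [mul_assoc, opD_mul_diag, ← mul_assoc, diag_mul_diag]
  have h3 : diag E * opD * (diag t * opD) = diag (fun n => E n * t (n + 1)) * opD * opD := by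
    rw [mul_assoc, ← mul_assoc opD, opD_mul_diag, ← mul_assoc, ← mul_assoc, diag_mul_diag]
  rw [diag_add, diag_add]
  simp only [mul_add, add_mul, h1, h2, h3]
  rw [mul_assoc mulX, diag_mul_diag, diag_mul_diag, ← mul_assoc (diag A), diag_mul_diag]
  abel

theorem smul_one_eq_diag (z : ℂ) : z • (1 : Module.End ℂ ℂ[X]) = diag fun _ => z := by
  rw [← diag_one, ← diag_const_mul]; simp

theorem diag_congr {s t : ℕ → ℂ} (h : ∀ n, s n = t n) : diag s = diag t := by rw [funext h]

theorem raising_polynomial_eq (c a : ℂ) :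
    mulX * linD c * linD c * linD c + a • (linD c * linD c) =
      mulX * diag (fun _ => 1) + diag (fun n => 3 * c * n + a) +
        diag (fun n => 3 * c ^ 2 * n + 2 * a * c) * opD +
        diag (fun n => c ^ 3 * n + a * c ^ 2) * opD * opD := by
  rw [diag_add, diag_add, diag_add, ← smul_one_eq_diag a, ← smul_one_eq_diag (2 * a * c),
    ← smul_one_eq_diag (a * c ^ 2), diag_const_mul, diag_const_mul, diag_const_mul,
    ← mulX_mul_opD, diag_one]
  simp only [linD, mul_add, add_mul, mul_one, one_mul, smul_mul_assoc, mul_smul_comm, smul_add,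
    smul_smul]
  module

section Kernel

variable {lam a : ℂ}

/-- The factor `1 - cD` clears the denominator, so that transporting `1 + μθ` through `K` yields a
triangular operator that can be cancelled on the right. -/
theorem diag_mul_kernelOp (hlam : lam ≠ 0) (μ : ℂ) :
    diag (fun n => 1 + μ * n) * toEnd (kernelOp lam a) * linD (-(lam * a / 2)) =
      toEnd (kernelOp lam a) * (diag (fun n => 1 + μ * n) +
        diag (fun n => μ * a - lam * a / 2 + μ * (lam * a / 2) * n) * opD) := by
  have h := theta_mul_kernelOp lam a hlam
  have e1 : diag (fun n => 1 + μ * n) = 1 + μ • (mulX * opD) := by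
    rw [mulX_mul_opD, ← diag_const_mul, ← diag_one, ← diag_add]
  have e2 : diag (fun n => μ * a - lam * a / 2 + μ * (lam * a / 2) * n) =
      (μ * a - lam * a / 2) • 1 + (μ * (lam * a / 2)) • (mulX * opD) := by
    rw [mulX_mul_opD, ← diag_const_mul, smul_one_eq_diag, ← diag_add]
  rw [e1, e2, add_mul, add_mul, smul_mul_assoc, smul_mul_assoc, h]
  simp only [linD, mul_add, add_mul, mul_one, one_mul, smul_mul_assoc, mul_smul_comm, smul_add,
    smul_smul, mul_assoc]
  module

/-- A criterion for the three-term form of `K⁻¹ x (1 + μθ)⁻¹ K`. -/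
theorem mulX_diag_mul_kernelOp (hlam : lam ≠ 0) (μ : ℂ) (hμ : ∀ n : ℕ, 1 + μ * n ≠ 0)
    (A E : ℕ → ℂ)
    (h0 : A 0 = a)
    (h1 : ∀ n : ℕ, A (n + 1) * (1 + μ * (n + 1)) + (n + 1) * ((1 + μ * n)⁻¹ *
      (μ * a - lam * a / 2 + μ * (lam * a / 2) * n)) = 3 * (lam * a / 2) * (n + 1) + a)
    (h2 : ∀ n : ℕ, A n * (μ * a - lam * a / 2 + μ * (lam * a / 2) * n) +
      E n * (1 + μ * (n + 1)) = 3 * (lam * a / 2) ^ 2 * n + 2 * a * (lam * a / 2))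
    (h3 : ∀ n : ℕ, E n * (μ * a - lam * a / 2 + μ * (lam * a / 2) * (n + 1)) =
      (lam * a / 2) ^ 3 * n + a * (lam * a / 2) ^ 2) :
    mulX * diag (fun n => (1 + μ * n)⁻¹) * toEnd (kernelOp lam a) =
      toEnd (kernelOp lam a) * (mulX * diag (fun n => (1 + μ * n)⁻¹) + diag A + diag E * opD) := by
  -- Multiplication by this operator amounts to inserting `(1 + μθ)K(1 - cD)`, which cancels `(1 +
  -- μθ)⁻¹` and leaves `xK(1 - cD)`. The hypotheses compare the coefficients of `1` (`h0`, `h1`),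
  -- `D` (`h2`) and `D²` (`h3`).
  refine mul_right_cancel_triangular (fun n => 1 + μ * n)
    (fun n => μ * a - lam * a / 2 + μ * (lam * a / 2) * n) hμ ?_
  rw [mul_assoc _ (toEnd _), ← diag_mul_kernelOp hlam, mul_assoc (toEnd _),
    three_term_mul_triangular, mul_assoc mulX, ← mul_assoc (diag _), ← mul_assoc (diag _),
    diag_mul_diag]
  have e1 : diag (fun n : ℕ => (1 + μ * n)⁻¹ * (1 + μ * n)) = 1 := by
    rw [← diag_one]; exact diag_congr fun n => inv_mul_cancel₀ (hμ n)
  rw [e1, one_mul, ← mul_assoc, mulX_mul_kernelOp lam a hlam, raising_polynomial_eq,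
    ← diag_one]
  have d1 : (fun n : ℕ => A n * (1 + μ * n) + n * ((1 + μ * ((n - 1 : ℕ) : ℂ))⁻¹ *
      (μ * a - lam * a / 2 + μ * (lam * a / 2) * ((n - 1 : ℕ) : ℂ)))) =
      fun n : ℕ => 3 * (lam * a / 2) * n + a := funext fun n => by
    cases n with
    | zero => simp [h0]
    | succ n => rw [Nat.add_sub_cancel]; push_cast; exact h1 n
  have d2 : (fun n : ℕ => A n * (μ * a - lam * a / 2 + μ * (lam * a / 2) * n) +
      E n * (1 + μ * ((n + 1 : ℕ) : ℂ))) =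
      fun n : ℕ => 3 * (lam * a / 2) ^ 2 * n + 2 * a * (lam * a / 2) := funext fun n => by
    push_cast; exact h2 n
  have d3 : (fun n : ℕ => E n *
      (μ * a - lam * a / 2 + μ * (lam * a / 2) * ((n + 1 : ℕ) : ℂ))) =
      fun n : ℕ => (lam * a / 2) ^ 3 * n + a * (lam * a / 2) ^ 2 := funext fun n => by
    push_cast; exact h3 n
  rw [d1, d2, d3]

/-- By the choice of `r`, `(1 + βn)/((1 + λn)(1 + κn)) = r/(1 + λn) + (1 - r)/(1 + κn)`, so it
suffices to treat `μ = λ` and `μ = κ`. -/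
theorem jacobiOp_three_term {kap : ℂ} (hlam : lam ≠ 0) (hkap : kap ≠ 0)
    (hlk : 1 / kap - 1 / lam = 1 / 2)
    (hl : ∀ n : ℕ, 1 + lam * n ≠ 0) (hk : ∀ n : ℕ, 1 + kap * n ≠ 0) (r : ℂ) :
    jacobiOp lam kap a (r * kap + (1 - r) * lam) =
      mulX * diag (jacobiRatio lam kap (r * kap + (1 - r) * lam)) +
        diag (jacobiDiagCoeff lam kap a r) + diag (jacobiLowerCoeff lam kap a r) * opD := by
  have hlk' : 2 * lam - 2 * kap = lam * kap := by field_simp at hlk; linear_combination hlk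
  have hl1 : ∀ n : ℕ, 1 + lam * ((n : ℂ) + 1) ≠ 0 := fun n => by exact_mod_cast hl (n + 1)
  have hk1 : ∀ n : ℕ, 1 + kap * ((n : ℂ) + 1) ≠ 0 := fun n => by exact_mod_cast hk (n + 1)
  have hk' : ∀ n : ℕ, 1 + (n : ℂ) * kap ≠ 0 := fun n => by rw [mul_comm]; exact hk n
  have hk1' : ∀ n : ℕ, 1 + ((n : ℂ) + 1) * kap ≠ 0 := fun n => by rw [mul_comm]; exact hk1 n
  have H1 := mulX_diag_mul_kernelOp (a := a) hlam lam hl (fun _ => a)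
    (fun n => lam * a ^ 2 / 4 * (2 + lam * n) / (1 + lam * (n + 1))) rfl
    (fun n => by have := hl n; field_simp; ring)
    (fun n => by have := hl1 n; field_simp; ring)
    (fun n => by have := hl1 n; field_simp; ring)
  have hcomb : ∀ s t : ℕ → ℂ, diag (fun n => r * s n + (1 - r) * t n) =
      r • diag s + (1 - r) • diag t := fun s t => by
    rw [diag_add, diag_const_mul, diag_const_mul]
  -- The relation between `κ` and `λ` makes the coefficient of `D` equal to `c(1 + κ(n - 1))`, which
  -- keeps the overdetermined system for `A` and `E` consistent.
  have hca : kap * a - lam * a / 2 = lam * a / 2 * (1 - kap) := by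
    linear_combination (-a / 2) * hlk'
  have H2 := mulX_diag_mul_kernelOp (a := a) hlam kap hk
    (fun n => a / 2 * (2 + lam * n) / (1 + kap * n) + a / 2 * (lam * n) / (1 + kap * (n - 1)))
    (fun n => lam * a ^ 2 / 4 * (2 + lam * n) / (1 + kap * n)) (by simp)
    (fun n => by
      have := hk n
      have := hk1 n
      have := hk' n
      have := hk1' n
      rw [hca]
      push_cast
      rw [add_sub_cancel_right]
      field_simp
      ring)
    (fun n => by
      have := hk n
      rw [hca]
      -- At `n = 0` the denominator `1 + κ(n - 1)` may vanish, but its numerator is zero.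
      cases n with
      | zero => simp; ring
      | succ n =>
        have := hk n
        have := hk1 n
        have := hk' n
        have := hk1' n
        push_cast
        rw [add_sub_cancel_right]
        field_simp
        ring)
    (fun n => by have := hk n; have := hk' n; rw [hca]; field_simp; ring)
  have e1 : jacobiRatio lam kap (r * kap + (1 - r) * lam) =
      fun n : ℕ => r * (1 + lam * n)⁻¹ + (1 - r) * (1 + kap * n)⁻¹ := funext fun n => by
    have := hk n
    have := hl n
    rw [jacobiRatio]; field_simp; ring
  have e2 : jacobiDiagCoeff lam kap a r = fun n : ℕ => r * a + (1 - r) *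
      (a / 2 * (2 + lam * n) / (1 + kap * n) + a / 2 * (lam * n) / (1 + kap * (n - 1))) := rfl
  have e3 : jacobiLowerCoeff lam kap a r = fun n : ℕ =>
      r * (lam * a ^ 2 / 4 * (2 + lam * n) / (1 + lam * (n + 1))) +
        (1 - r) * (lam * a ^ 2 / 4 * (2 + lam * n) / (1 + kap * n)) := funext fun n => by
    rw [jacobiLowerCoeff]; ring
  refine (conj_inv_eq_iff (kernelOp lam a) _ _).mpr ?_
  rw [e1, e2, e3, hcomb, hcomb, hcomb]
  simp only [mul_add, add_mul, mul_smul_comm, smul_mul_assoc] at H1 H2 ⊢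
  rw [H1, H2]
  module

end Kernel

/-! ### Monic families -/

theorem isMonicFamily_iff (G : ℂ[X] ≃ₗ[ℂ] ℂ[X]) :
    IsMonicFamily G ↔ ∀ n : ℕ, G (X ^ n) - X ^ n ∈ degreeLT ℂ n := by
  refine forall_congr' fun n => ?_
  rw [mem_degreeLT]
  constructor
  · rintro ⟨h1, h2⟩
    have h3 : (G (X ^ n)).degree = n := by rw [degree_eq_natDegree h1.ne_zero, h2]
    have := degree_sub_lt_left (h3.trans (degree_X_pow n).symm) h1.ne_zero
      (by rw [h1.leadingCoeff, (monic_X_pow n).leadingCoeff])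
    rwa [h3] at this
  · intro h
    have h1 : G (X ^ n) = X ^ n + (G (X ^ n) - X ^ n) := by ring
    have h2 : (G (X ^ n) - X ^ n).degree < ((X : ℂ[X]) ^ n).degree := by rwa [degree_X_pow]
    refine ⟨?_, ?_⟩
    · rw [h1]; exact (monic_X_pow n).add_of_left h2
    · rw [h1, natDegree_add_eq_left_of_degree_lt h2, natDegree_X_pow]

/-- The disjunction covers unitriangular and diagonal operators at once; both are needed for
conjugation by a diagonal operator. -/
theorem map_mem_degreeLT {A : Module.End ℂ ℂ[X]}
    (hA : ∀ n : ℕ, A (X ^ n) - X ^ n ∈ degreeLT ℂ n ∨ ∃ z : ℂ, A (X ^ n) = z • X ^ n)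
    {n : ℕ} {p : ℂ[X]} (hp : p ∈ degreeLT ℂ n) : A p ∈ degreeLT ℂ n := by
  classical
  have hle : degreeLT ℂ n ≤ (degreeLT ℂ n).comap A := by
    conv_lhs => rw [degreeLT_eq_span_X_pow]
    rw [Submodule.span_le]
    intro q hq
    simp only [Finset.coe_image, Finset.coe_range, Set.mem_image, Set.mem_Iio] at hq
    obtain ⟨k, hk, rfl⟩ := hq
    have hX : (X : ℂ[X]) ^ k ∈ degreeLT ℂ n := by
      rw [mem_degreeLT, degree_X_pow]; exact_mod_cast hk
    rw [SetLike.mem_coe, Submodule.mem_comap]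
    rcases hA k with h | ⟨z, h⟩
    · have := (degreeLT ℂ n).add_mem (degreeLT_mono hk.le h) hX
      rwa [sub_add_cancel] at this
    · rw [h]; exact (degreeLT ℂ n).smul_mem z hX
  exact hle hp

theorem IsMonicFamily.mul {G G' : ℂ[X] ≃ₗ[ℂ] ℂ[X]} (hG : IsMonicFamily G)
    (hG' : IsMonicFamily G') : IsMonicFamily (G * G') := by
  rw [isMonicFamily_iff] at *
  intro n
  have h := map_mem_degreeLT (A := toEnd G) (fun k => Or.inl (hG k)) (hG' n)
  have := (degreeLT ℂ n).add_mem h (hG n)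
  simpa using this

theorem IsMonicFamily.conj_diag {G : ℂ[X] ≃ₗ[ℂ] ℂ[X]} (hG : IsMonicFamily G) (s : ℕ → ℂ)
    (hs : ∀ n, s n ≠ 0) : IsMonicFamily ((diagEquiv s hs)⁻¹ * G * diagEquiv s hs) := by
  rw [isMonicFamily_iff] at *
  intro n
  have hF : ∀ k, (diagEquiv s hs)⁻¹ (X ^ k) = (s k)⁻¹ • (X : ℂ[X]) ^ k := fun k =>
    diag_X_pow _ k
  have h := map_mem_degreeLT (A := toEnd (diagEquiv s hs)⁻¹) (fun k => Or.inr ⟨_, hF k⟩) (hG n)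
  have h2 := (degreeLT ℂ n).smul_mem (s n) h
  have h3 : diagEquiv s hs (X ^ n) = s n • (X : ℂ[X]) ^ n := diag_X_pow s n
  rw [LinearEquiv.mul_apply, LinearEquiv.mul_apply, h3, map_smul, map_smul]
  rw [toEnd, LinearEquiv.coe_coe, map_sub, hF, smul_sub, smul_smul, mul_inv_cancel₀ (hs n),
    one_smul] at h2
  exact h2

theorem constantCoeff_serV (lam a : ℂ) : PowerSeries.constantCoeff (serV lam a) = 1 := by
  have hs := hasSubst_mob (lam * a / 2)
  set w := cpow (PowerSeries.derivative ℂ (serF lam a)) (-1 / lam) with hw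
  have h1 : PowerSeries.constantCoeff w = 1 :=
    constantCoeff_cpow _ _ (isDelta_serF lam a).constantCoeff_derivative
  obtain ⟨q, hq⟩ : PowerSeries.X ∣ w - 1 := by rw [PowerSeries.X_dvd_iff]; simp [h1]
  have h2 : w = 1 + PowerSeries.X * q := by rw [← hq]; ring
  have h3 : (PowerSeries.subst (mob (lam * a / 2)) (1 : PowerSeries ℂ) : PowerSeries ℂ) = 1 := by
    rw [← PowerSeries.coe_substAlgHom hs, map_one]
  rw [serV, ← hw, h2, PowerSeries.subst_add hs, PowerSeries.subst_mul hs, PowerSeries.subst_X hs,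
    h3, map_add, map_mul, (isDelta_mob _).1]
  simp

theorem isDelta_serU (c : ℂ) : IsDelta (serU c) := by
  have h := serU_mul c
  have h0 : PowerSeries.constantCoeff (serU c) = 0 := by
    have := congrArg PowerSeries.constantCoeff h
    simpa [constantCoeff_lin] using this
  refine ⟨h0, ?_⟩
  obtain ⟨q, hq⟩ := PowerSeries.X_dvd_iff.mpr h0
  have h1 : q * lin c ^ 2 = 1 := by
    refine mul_left_cancel₀ PowerSeries.X_ne_zero ?_
    rw [← mul_assoc, ← hq, h, mul_one]
  have := congrArg PowerSeries.constantCoeff h1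
  rw [hq, ← zero_add 1, PowerSeries.coeff_succ_X_mul,
    PowerSeries.coeff_zero_eq_constantCoeff_apply]
  simpa [constantCoeff_lin] using this

/-- The symbol `v u ^ m` starts with `y ^ m`, which makes `K` unitriangular. -/
theorem isMonicFamily_kernelOp (lam a : ℂ) : IsMonicFamily (kernelOp lam a) := by
  rw [isMonicFamily_iff]
  intro n
  rw [mem_degreeLT, degree_lt_iff_coeff_zero]
  intro m hm
  have h := hasSymbol_kernelOp lam a n m
  have hm0 := Nat.cast_ne_zero (R := ℂ).mpr m.factorial_ne_zero
  rw [coeff_sub, coeff_X_pow]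
  rcases hm.lt_or_eq with hlt | rfl
  · have hd : PowerSeries.X ^ m ∣ kernelSymbol lam a m :=
      (pow_dvd_pow_of_dvd (PowerSeries.X_dvd_iff.mpr (isDelta_serU _).1) m).mul_left _
    rw [PowerSeries.X_pow_dvd_iff.mp hd n hlt, mul_zero] at h
    rw [if_neg hlt.ne', sub_zero]
    exact (mul_eq_zero.mp h).resolve_left hm0
  · rw [if_pos rfl, sub_eq_zero]
    refine mul_left_cancel₀ hm0 (h.trans ?_)
    congr 1
    obtain ⟨q, hq⟩ : PowerSeries.X ∣ serV lam a - 1 := by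
      rw [PowerSeries.X_dvd_iff]; simp [constantCoeff_serV]
    have h2 : serV lam a = 1 + PowerSeries.X * q := by rw [← hq]; ring
    have hd : PowerSeries.X ^ (n + 1) ∣ PowerSeries.X * q * serU (lam * a / 2) ^ n := by
      rw [mul_assoc, pow_succ']
      exact mul_dvd_mul_left _ (Dvd.dvd.mul_left
        (pow_dvd_pow_of_dvd (PowerSeries.X_dvd_iff.mpr (isDelta_serU _).1) n) q)
    rw [kernelSymbol, h2, add_mul, one_mul, map_add, (isDelta_serU _).coeff_pow_self,
      PowerSeries.X_pow_dvd_iff.mp hd n (Nat.lt_succ_self n), add_zero]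

theorem isMonicFamily_shiftedOp (l : ℕ → ℂ) : IsMonicFamily (shiftedOp l) := fun n => by
  have h : shiftedOp l (X ^ n) = ∏ k ∈ Finset.range n, (X + C (l k)) := familyOp_X_pow _ _ _ n
  rw [h]
  refine ⟨monic_prod_of_monic _ _ fun k _ => monic_X_add_C (l k), ?_⟩
  rw [natDegree_prod_of_monic _ _ fun k _ => monic_X_add_C (l k)]
  simp

theorem IsMonicFamily.map_one {G : ℂ[X] ≃ₗ[ℂ] ℂ[X]} (hG : IsMonicFamily G) : G 1 = 1 := by
  obtain ⟨h1, h2⟩ := hG 0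
  rw [pow_zero] at h1 h2
  exact h1.natDegree_eq_zero.mp h2

theorem mulX_apply (p : ℂ[X]) : mulX p = X * p := rfl

theorem dualRaising_apply_inv (G : ℂ[X] ≃ₗ[ℂ] ℂ[X]) (p : ℂ[X]) :
    dualRaising G (G⁻¹ p) = G⁻¹ (X * p) := by
  have h := (conj_inv_eq_iff G mulX (dualRaising G)).mp rfl
  have h2 : X * G (G⁻¹ p) = G (dualRaising G (G⁻¹ p)) := LinearMap.congr_fun h (G⁻¹ p)
  have h3 : G (G⁻¹ p) = p := G.apply_symm_apply p
  rw [h3] at h2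
  rw [h2]
  exact (G.symm_apply_apply _).symm

/-- A monic family is determined by its dual raising operator. -/
theorem eq_of_dualRaising_eq {G G' : ℂ[X] ≃ₗ[ℂ] ℂ[X]} (hG : IsMonicFamily G)
    (hG' : IsMonicFamily G') (h : dualRaising G = dualRaising G') : G = G' := by
  refine inv_injective (equiv_ext fun n => ?_)
  induction n with
  | zero =>
    have h1 : G.symm 1 = 1 := by rw [LinearEquiv.symm_apply_eq, hG.map_one]
    have h2 : G'.symm 1 = 1 := by rw [LinearEquiv.symm_apply_eq, hG'.map_one]
    rw [pow_zero]
    exact h1.trans h2.symm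
  | succ n ih => rw [pow_succ', ← dualRaising_apply_inv, ← dualRaising_apply_inv, ih, h]

/-! ### Moments of a family with a three-term dual raising operator -/

theorem X_mul_family {G : ℂ[X] ≃ₗ[ℂ] ℂ[X]} {A B : ℕ → ℂ}
    (h : dualRaising G = mulX + diag A + diag B * opD) (n : ℕ) :
    X * G (X ^ n) = G (X ^ (n + 1)) + A n • G (X ^ n) +
      ((n : ℂ) * B (n - 1)) • G (X ^ (n - 1)) := by
  have h1 := (conj_inv_eq_iff G mulX _).mp h
  have h2 := LinearMap.congr_fun h1 (X ^ n)
  have h3 := three_term_X_pow (fun _ => 1) A B n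
  rw [diag_one, mul_one] at h3
  rw [Module.End.mul_apply, Module.End.mul_apply, h3] at h2
  simpa [mulX_apply] using h2

theorem moment_family_mul {G : ℂ[X] ≃ₗ[ℂ] ℂ[X]} (hG : IsMonicFamily G) {A B : ℕ → ℂ}
    (h : dualRaising G = mulX + diag A + diag B * opD) (m n : ℕ) :
    moment G (G (X ^ m) * G (X ^ n)) =
      if m = n then (n.factorial : ℂ) * ∏ k ∈ Finset.range n, B k else 0 := by
  have hadd : ∀ p q, moment G (p + q) = moment G p + moment G q := fun p q => by
    simp [moment]
  have hsmul : ∀ (z : ℂ) p, moment G (z • p) = z * moment G p := fun z p => by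
    simp [moment]
  -- The factor `x` in `x p_m p_n` can be expanded through either polynomial; equating the two
  -- expansions lowers `m`.
  have hrec : ∀ m n : ℕ, moment G (G (X ^ (m + 1)) * G (X ^ n)) =
      moment G (G (X ^ m) * G (X ^ (n + 1))) +
        (A n - A m) * moment G (G (X ^ m) * G (X ^ n)) +
        n * B (n - 1) * moment G (G (X ^ m) * G (X ^ (n - 1))) -
        m * B (m - 1) * moment G (G (X ^ (m - 1)) * G (X ^ n)) := fun m n => by
    have h1 : G (X ^ (m + 1)) * G (X ^ n) + A m • (G (X ^ m) * G (X ^ n)) +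
        ((m : ℂ) * B (m - 1)) • (G (X ^ (m - 1)) * G (X ^ n)) =
        G (X ^ m) * G (X ^ (n + 1)) + A n • (G (X ^ m) * G (X ^ n)) +
        ((n : ℂ) * B (n - 1)) • (G (X ^ m) * G (X ^ (n - 1))) := by
      have e1 := X_mul_family h m
      have e2 := X_mul_family h n
      simp only [smul_eq_C_mul] at e1 e2 ⊢
      linear_combination G (X ^ m) * e2 - G (X ^ n) * e1
    have h2 := congrArg (moment G) h1
    simp only [hadd, hsmul] at h2
    linear_combination h2
  have h0 : ∀ n : ℕ, moment G (G (X ^ 0) * G (X ^ n)) =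
      if 0 = n then (n.factorial : ℂ) * ∏ k ∈ Finset.range n, B k else 0 := fun n => by
    have : G⁻¹ (G (X ^ n)) = X ^ n := G.symm_apply_apply _
    rw [pow_zero, hG.map_one, one_mul, moment, this]
    cases n with
    | zero => simp
    | succ n => simp
  induction m using Nat.strong_induction_on generalizing n with
  | _ m ih =>
    cases m with
    | zero => exact h0 n
    | succ m =>
      rw [hrec, ih m (Nat.lt_succ_self m), ih m (Nat.lt_succ_self m), ih m (Nat.lt_succ_self m),
        ih (m - 1) (by omega)]
      -- For `n = m + 1` only the term with `B (n - 1)` survives; for `m = n + 1` the first and last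
      -- terms cancel; for `m = n` the factor `A n - A m` vanishes.
      rcases eq_or_ne n (m + 1) with rfl | h1
      · rw [if_neg (by omega), if_neg (by omega), if_neg (by omega : ¬ m - 1 = m + 1),
          Nat.add_sub_cancel, if_pos rfl, if_pos rfl, Finset.prod_range_succ, Nat.factorial_succ]
        push_cast; ring
      rw [if_neg h1.symm]
      rcases eq_or_ne m (n + 1) with rfl | h2
      · rw [if_pos rfl, if_neg (by omega), if_neg (by omega : ¬ n + 1 = n - 1),
          Nat.add_sub_cancel, if_pos rfl, Finset.prod_range_succ, Nat.factorial_succ]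
        push_cast; ring
      rw [if_neg h2]
      rcases eq_or_ne m n with rfl | h3
      · cases m with
        | zero => simp
        | succ m => rw [if_neg (by omega : ¬ m + 1 = m + 1 - 1),
            if_neg (by omega : ¬ m + 1 - 1 = m + 1)]; ring
      · rw [if_neg h3, if_neg (by omega), if_neg (by omega)]; ring

/-! ### The Jacobi and Wilson families -/

theorem conj_inv_eq_iff_eq_conj (e : ℂ[X] ≃ₗ[ℂ] ℂ[X]) (A B : Module.End ℂ ℂ[X]) :
    LinearEquiv.conj e⁻¹ A = B ↔ A = LinearEquiv.conj e B := by
  rw [conj_inv_eq_iff, eq_comm (a := A), conj_eq_iff, eq_comm]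

theorem jacobiG_eq (lam kap a b : ℂ) (hF : ∀ n, jacobiRatio lam kap b n ≠ 0) :
    jacobiG lam kap a b hF = (ratioDiag (jacobiRatio lam kap b) hF)⁻¹ * kernelOp lam a *
      ratioDiag (jacobiRatio lam kap b) hF := by
  simp only [jacobiG, kernelOp, mul_assoc]

theorem wilsonG_eq (lam kap a β β' h : ℂ) (hH : ∀ n, wilsonRatio lam kap β β' h n ≠ 0) :
    wilsonG lam kap a β β' h hH = shiftedOp (wilsonShift lam kap a β h) *
      ((ratioDiag (wilsonRatio lam kap β β' h) hH)⁻¹ * kernelOp lam a *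
        ratioDiag (wilsonRatio lam kap β β' h) hH) := by
  simp only [wilsonG, kernelOp, mul_assoc]

theorem jacobiOp_eq (lam kap a b : ℂ) :
    jacobiOp lam kap a b =
      LinearEquiv.conj (kernelOp lam a)⁻¹ (mulX * diag (jacobiRatio lam kap b)) := by
  rw [jacobiOp, kernelOp]

theorem isMonicFamily_jacobiG (lam kap a b : ℂ) (hF : ∀ n, jacobiRatio lam kap b n ≠ 0) :
    IsMonicFamily (jacobiG lam kap a b hF) := by
  rw [jacobiG_eq, ratioDiag]
  exact (isMonicFamily_kernelOp lam a).conj_diag _ (prodSeq_ne_zero _ hF)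

theorem isMonicFamily_wilsonG (lam kap a β β' h : ℂ)
    (hH : ∀ n, wilsonRatio lam kap β β' h n ≠ 0) :
    IsMonicFamily (wilsonG lam kap a β β' h hH) := by
  rw [wilsonG_eq, ratioDiag]
  exact (isMonicFamily_shiftedOp _).mul
    ((isMonicFamily_kernelOp lam a).conj_diag _ (prodSeq_ne_zero _ hH))

theorem conj_dualRaising_jacobiG (lam kap a b : ℂ) (hF : ∀ n, jacobiRatio lam kap b n ≠ 0) :
    LinearEquiv.conj (ratioDiag (jacobiRatio lam kap b) hF)
      (dualRaising (jacobiG lam kap a b hF)) = jacobiOp lam kap a b := by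
  rw [dualRaising, ← conj_mul_equiv, jacobiOp_eq, ← conj_ratioDiag_mulX _ hF, ← conj_mul_equiv,
    jacobiG_eq]
  generalize ratioDiag (jacobiRatio lam kap b) hF = F
  have e : F * (F⁻¹ * kernelOp lam a * F)⁻¹ = (kernelOp lam a)⁻¹ * F := by group
  rw [e]

theorem conj_kernelOp_sq {lam kap : ℂ} (a : ℂ) (hlam : lam ≠ 0) (hkap : kap ≠ 0)
    (hlk : 1 / kap - 1 / lam = 1 / 2) :
    LinearEquiv.conj (kernelOp lam a) (diag fun n => (1 + lam * n) ^ 2) =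
      diag (fun n => (1 + lam * n) ^ 2) -
        (2 * a * lam ^ 2 / kap) • (diag (fun n => (1 + lam * n) * (1 + kap * n)) * opD) :=
  (conj_eq_iff _ _ _).mpr (kernelOp_mul_sq lam a kap hlam hkap hlk)

/-- Conjugating the relation for `K` by `F_θ⁻¹` replaces `D` by `(F_{θ+1}/F_θ)D`, whose denominator
cancels `(1 + λθ)(1 + κθ)`. -/
theorem conj_jacobiG_sq {lam kap : ℂ} (a b : ℂ) (hlam : lam ≠ 0) (hkap : kap ≠ 0)
    (hlk : 1 / kap - 1 / lam = 1 / 2)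
    (hl : ∀ n : ℕ, 1 + lam * n ≠ 0) (hk : ∀ n : ℕ, 1 + kap * n ≠ 0)
    (hF : ∀ n, jacobiRatio lam kap b n ≠ 0) :
    LinearEquiv.conj (jacobiG lam kap a b hF) (diag fun n => (1 + lam * n) ^ 2) =
      diag (fun n => (1 + lam * n) ^ 2)
        - (2 * a * lam ^ 2 / kap) • (diag (fun n => 1 + b * n) * opD) := by
  have h1 : diag (fun n => 1 + b * n) =
      diag (fun n => (1 + lam * n) * (1 + kap * n)) * diag (jacobiRatio lam kap b) := by
    rw [diag_mul_diag]
    refine diag_congr fun n => ?_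
    rw [jacobiRatio, mul_div_cancel₀ _ (mul_ne_zero (hl n) (hk n))]
  rw [jacobiG_eq, conj_mul_equiv, conj_mul_equiv, conj_ratioDiag_diag,
    conj_kernelOp_sq a hlam hkap hlk, conj_inv_eq_iff_eq_conj, map_sub, map_smul, h1, mul_assoc (diag _),
    conj_mul_end, conj_ratioDiag_opD, conj_ratioDiag_diag, conj_ratioDiag_diag]

/-! ### The operator `C̃₂` -/

theorem shiftedOp_X_pow (l : ℕ → ℂ) (n : ℕ) :
    shiftedOp l (X ^ n) = ∏ k ∈ Finset.range n, (X + C (l k)) := familyOp_X_pow _ _ _ n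

theorem conj_inv_shiftedOp (l : ℕ → ℂ) :
    LinearEquiv.conj (shiftedOp l)⁻¹ mulX = mulX - diag l := by
  rw [conj_inv_eq_iff]
  refine end_ext fun n => ?_
  rw [Module.End.mul_apply, Module.End.mul_apply, LinearMap.sub_apply, mulX_X_pow, diag_X_pow,
    LinearEquiv.coe_coe, map_sub, map_smul, mulX_apply, shiftedOp_X_pow, shiftedOp_X_pow,
    Finset.prod_range_succ, smul_eq_C_mul]
  ring

theorem eq_shiftedOp_iff (l : ℕ → ℂ) (T : ℂ[X] ≃ₗ[ℂ] ℂ[X]) :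
    (T 1 = 1 ∧ LinearEquiv.conj T⁻¹ mulX = mulX - diag l) ↔ T = shiftedOp l := by
  constructor
  · rintro ⟨h1, h2⟩
    refine equiv_ext fun n => ?_
    rw [conj_inv_eq_iff] at h2
    induction n with
    | zero => rw [pow_zero, h1, (isMonicFamily_shiftedOp l).map_one]
    | succ n ih =>
      have h3 := LinearMap.congr_fun h2 (X ^ n)
      rw [Module.End.mul_apply, Module.End.mul_apply, LinearMap.sub_apply, mulX_X_pow, diag_X_pow,
        LinearEquiv.coe_coe, map_sub, map_smul, mulX_apply, ih, smul_eq_C_mul] at h3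
      rw [shiftedOp_X_pow, Finset.prod_range_succ, ← shiftedOp_X_pow]
      linear_combination -h3
  · rintro rfl
    exact ⟨(isMonicFamily_shiftedOp l).map_one, conj_inv_shiftedOp l⟩

section Wilson

variable {lam kap a h : ℂ}

/-- After conjugation by `K`, both sides are `x` times a diagonal operator plus a diagonal operator:
the `x` parts agree by the choice of `H_θ`, the diagonal parts by the choice of `ℓ`. -/
theorem conj_dualRaising_wilsonG (hlam : lam ≠ 0) (hkap : kap ≠ 0)
    (hlk : 1 / kap - 1 / lam = 1 / 2)
    (hl : ∀ n : ℕ, 1 + lam * n ≠ 0) (hk : ∀ n : ℕ, 1 + kap * n ≠ 0) (β β' : ℂ)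
    (hH : ∀ n, wilsonRatio lam kap β β' h n ≠ 0) :
    LinearEquiv.conj (ratioDiag (wilsonRatio lam kap β β' h) hH)
      (dualRaising (wilsonG lam kap a β β' h hH)) =
        h • (diag (fun n => (1 + lam * n) ^ 2) * jacobiOp lam kap a β)
          + (1 - h) • jacobiOp lam kap a β' := by
  set H := ratioDiag (wilsonRatio lam kap β β' h) hH with hHdef
  set K := kernelOp lam a with hK
  set S := shiftedOp (wilsonShift lam kap a β h) with hS
  have h1 : LinearEquiv.conj H (dualRaising (wilsonG lam kap a β β' h hH)) =
      LinearEquiv.conj K⁻¹ (LinearEquiv.conj H (LinearEquiv.conj S⁻¹ mulX)) := by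
    rw [dualRaising, wilsonG_eq, ← hS, ← hK, ← hHdef, ← conj_mul_equiv, ← conj_mul_equiv,
      ← conj_mul_equiv]
    have e : H * (S * (H⁻¹ * K * H))⁻¹ = K⁻¹ * H * S⁻¹ := by group
    rw [e]
  have h2 : diag (fun n => (1 + lam * n) ^ 2) = LinearEquiv.conj K⁻¹
      (diag (fun n => (1 + lam * n) ^ 2) - (2 * a * lam ^ 2 / kap) •
        (diag (fun n => (1 + lam * n) * (1 + kap * n)) * opD)) := by
    rw [eq_comm, conj_inv_eq_iff_eq_conj, conj_kernelOp_sq a hlam hkap hlk]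
  rw [h1, conj_inv_shiftedOp, map_sub, conj_ratioDiag_mulX, conj_ratioDiag_diag, jacobiOp_eq,
    jacobiOp_eq]
  conv_rhs => rw [h2]
  rw [← conj_mul_end, ← map_smul, ← map_smul, ← map_add]
  congr 1
  have e1 : diag (fun n => (1 + lam * n) ^ 2) * (mulX * diag (jacobiRatio lam kap β)) =
      mulX * diag fun n => (1 + lam * (n + 1)) ^ 2 * jacobiRatio lam kap β n := by
    rw [← mul_assoc, diag_mul_mulX, mul_assoc, diag_mul_diag]
    push_cast; rfl
  -- Here `Dx = θ + 1` and the denominators cancel, which explains the form of `ℓ`.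
  have e2 : diag (fun n => (1 + lam * n) * (1 + kap * n)) * opD *
      (mulX * diag (jacobiRatio lam kap β)) = diag fun n => (1 + n) * (1 + β * n) := by
    rw [mul_assoc, opD_mul_mulX, diag_mul_diag]
    refine diag_congr fun n => ?_
    have : (1 + lam * n) * (1 + kap * n) ≠ 0 := mul_ne_zero (hl n) (hk n)
    rw [jacobiRatio, mul_left_comm, mul_div_cancel₀ _ this]; ring
  have e3 : wilsonRatio lam kap β β' h = fun n : ℕ =>
      h * ((1 + lam * (n + 1)) ^ 2 * jacobiRatio lam kap β n) +
        (1 - h) * jacobiRatio lam kap β' n := funext fun n => by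
    rw [wilsonRatio, jacobiRatio, jacobiRatio]; ring
  have e4 : wilsonShift lam kap a β h = fun n : ℕ =>
      h * ((2 * a * lam ^ 2 / kap) * ((1 + n) * (1 + β * n))) := funext fun n => by
    rw [wilsonShift]; ring
  rw [e3, e4, sub_mul, smul_mul_assoc, e1, e2, diag_add, diag_const_mul, diag_const_mul,
    diag_const_mul, diag_const_mul, mul_add, mul_smul_comm, mul_smul_comm, smul_sub]
  abel

theorem dualRaising_wilsonG (hlam : lam ≠ 0) (hkap : kap ≠ 0)
    (hlk : 1 / kap - 1 / lam = 1 / 2)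
    (hl : ∀ n : ℕ, 1 + lam * n ≠ 0) (hk : ∀ n : ℕ, 1 + kap * n ≠ 0) {r r' β β' : ℂ}
    (hβ : β = r * kap + (1 - r) * lam) (hβ' : β' = r' * kap + (1 - r') * lam)
    (hH : ∀ n, wilsonRatio lam kap β β' h n ≠ 0) :
    dualRaising (wilsonG lam kap a β β' h hH) =
      mulX + diag (wilsonA lam kap a r r' h) + diag (wilsonB lam kap a r r' h) * opD := by
  have hJ := jacobiOp_three_term (a := a) hlam hkap hlk hl hk r
  have hJ' := jacobiOp_three_term (a := a) hlam hkap hlk hl hk r'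
  rw [← hβ] at hJ
  rw [← hβ'] at hJ'
  refine (LinearEquiv.conj (ratioDiag (wilsonRatio lam kap β β' h) hH)).injective ?_
  rw [conj_dualRaising_wilsonG hlam hkap hlk hl hk, hJ, hJ']
  have e1 : diag (fun n => (1 + lam * n) ^ 2) * (mulX * diag (jacobiRatio lam kap β)) =
      mulX * diag fun n => (1 + lam * (n + 1)) ^ 2 * jacobiRatio lam kap β n := by
    rw [← mul_assoc, diag_mul_mulX, mul_assoc, diag_mul_diag]
    push_cast; rfl
  have e3 : wilsonRatio lam kap β β' h = fun n : ℕ =>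
      h * ((1 + lam * (n + 1)) ^ 2 * jacobiRatio lam kap β n) +
        (1 - h) * jacobiRatio lam kap β' n := funext fun n => by
    rw [wilsonRatio, jacobiRatio, jacobiRatio]; ring
  have e4 : wilsonA lam kap a r r' h = fun n : ℕ =>
      h * ((1 + lam * n) ^ 2 * jacobiDiagCoeff lam kap a r n)
        + (1 - h) * jacobiDiagCoeff lam kap a r' n := funext fun n => by
    rw [wilsonA]; ring
  have e5 : diag (wilsonB lam kap a r r' h) = diag (fun n : ℕ =>
      h * ((1 + lam * n) ^ 2 * jacobiLowerCoeff lam kap a r n)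
        + (1 - h) * jacobiLowerCoeff lam kap a r' n) * diag (wilsonRatio lam kap β β' h) := by
    rw [diag_mul_diag]
    refine diag_congr fun n => ?_
    rw [wilsonB, ← hβ, ← hβ']; ring
  rw [map_add, map_add, conj_ratioDiag_mulX, conj_ratioDiag_diag, e5, mul_assoc, conj_mul_end,
    conj_ratioDiag_opD, conj_ratioDiag_diag, e4, e3]
  simp only [diag_add, diag_const_mul]
  rw [← diag_mul_diag (fun n : ℕ => (1 + lam * n) ^ 2) (jacobiDiagCoeff lam kap a r),
    ← diag_mul_diag (fun n : ℕ => (1 + lam * n) ^ 2) (jacobiLowerCoeff lam kap a r),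
    mul_add (diag _), mul_add (diag _), e1, ← mul_assoc]
  rw [mul_add mulX, mul_smul_comm, mul_smul_comm, add_mul, smul_mul_assoc, smul_mul_assoc,
    smul_add, smul_add, smul_add, smul_add]
  abel

/-! ### Nondegeneracy and orthogonality -/

theorem two_add_lam_mul_ne_zero (hlam : lam ≠ 0) (hkap : kap ≠ 0)
    (hlk : 1 / kap - 1 / lam = 1 / 2)
    (hl : ∀ n : ℕ, 1 + lam * n ≠ 0) (hk : ∀ n : ℕ, 1 + kap * n ≠ 0) (n : ℕ) :
    2 + lam * n ≠ 0 := by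
  intro h0
  have hlk' : 2 * lam - 2 * kap = lam * kap := by field_simp at hlk; linear_combination hlk
  rcases Nat.even_or_odd' n with ⟨m, rfl | rfl⟩
  -- For `n = 2m` the quantity is `2(1 + λm)`; for `n = 2m + 1` it is `(2λ/κ)(1 + κm)`, by the
  -- relation between `κ` and `λ`.
  · apply hl m
    push_cast at h0
    linear_combination h0 / 2
  · apply hk m
    push_cast at h0
    refine (mul_eq_zero.mp (?_ : lam * (1 + kap * m) = 0)).resolve_left hlam
    linear_combination (kap / 2) * h0 + hlk' / 2

/-- Over the common denominator of the two fractions, the coefficient is `a²` times the displayed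
bracket times factors that never vanish. -/
theorem wilsonB_ne_zero_iff (hlam : lam ≠ 0) (hkap : kap ≠ 0)
    (hlk : 1 / kap - 1 / lam = 1 / 2)
    (hl : ∀ n : ℕ, 1 + lam * n ≠ 0) (hk : ∀ n : ℕ, 1 + kap * n ≠ 0) (r r' : ℂ)
    (hH : ∀ n, wilsonRatio lam kap (r * kap + (1 - r) * lam) (r' * kap + (1 - r') * lam) h n ≠ 0)
    (n : ℕ) :
    wilsonB lam kap a r r' h n ≠ 0 ↔ a ≠ 0 ∧
      h * (1 + lam * n) ^ 2 * (r * (1 + kap * n) + (1 - r) * (1 + lam * (n + 1)))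
          + (1 - h) * (r' * (1 + kap * n) + (1 - r') * (1 + lam * (n + 1))) ≠ 0 := by
  have h1 := hk n
  have h2 : 1 + lam * ((n : ℂ) + 1) ≠ 0 := by exact_mod_cast hl (n + 1)
  have h3 := two_add_lam_mul_ne_zero hlam hkap hlk hl hk n
  have hJ : ∀ s, jacobiLowerCoeff lam kap a s n = lam * a ^ 2 / 4 * (2 + lam * n) /
      ((1 + lam * (n + 1)) * (1 + kap * n)) *
      (s * (1 + kap * n) + (1 - s) * (1 + lam * (n + 1))) := fun s => by
    rw [jacobiLowerCoeff, div_add_div _ _ h2 h1]; ring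
  have hB : wilsonB lam kap a r r' h n = a ^ 2 * (lam / 4 * (2 + lam * n) /
      ((1 + lam * (n + 1)) * (1 + kap * n)) *
      wilsonRatio lam kap (r * kap + (1 - r) * lam) (r' * kap + (1 - r') * lam) h n) *
      (h * (1 + lam * n) ^ 2 * (r * (1 + kap * n) + (1 - r) * (1 + lam * (n + 1)))
          + (1 - h) * (r' * (1 + kap * n) + (1 - r') * (1 + lam * (n + 1)))) := by
    rw [wilsonB, hJ, hJ]; ring
  have h4 : lam / 4 * (2 + lam * n) / ((1 + lam * (n + 1)) * (1 + kap * n)) *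
      wilsonRatio lam kap (r * kap + (1 - r) * lam) (r' * kap + (1 - r') * lam) h n ≠ 0 :=
    mul_ne_zero (div_ne_zero (mul_ne_zero (div_ne_zero hlam (by norm_num)) h3)
      (mul_ne_zero h2 h1)) (hH n)
  rw [hB, mul_ne_zero_iff, mul_ne_zero_iff, pow_ne_zero_iff two_ne_zero]
  tauto

/-- A monic family with a three-term dual raising operator is orthogonal if and only if its
lowering coefficients do not vanish. -/
theorem isOrthogonalFamily_iff {G : ℂ[X] ≃ₗ[ℂ] ℂ[X]} (hG : IsMonicFamily G) {A B : ℕ → ℂ}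
    (hR : dualRaising G = mulX + diag A + diag B * opD) :
    IsOrthogonalFamily G ↔ ∀ n, B n ≠ 0 := by
  constructor
  · rintro ⟨-, s, b, hb, h⟩ n
    rw [hR, opD_mul_diag] at h
    have h1 := three_term_X_pow (fun _ => 1) A B (n + 1)
    have h2 := three_term_X_pow (fun _ => 1) s (fun n => b (n + 1)) (n + 1)
    rw [diag_one, mul_one] at h1 h2
    rw [h, h2] at h1
    -- The coefficient of `x ^ n` in the image of `x ^ (n+1)` is `n + 1` times the lowering
    -- coefficient.
    have h3 := congrArg (fun p => coeff p n) h1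
    simp [coeff_X_pow] at h3
    rcases h3 with h3 | h3
    · rw [← h3]; exact hb (n + 1)
    · exact absurd h3 n.cast_add_one_ne_zero
  · intro hB
    -- The value at `0` is an arbitrary nonzero number, because `D` kills constants.
    refine ⟨hG, A, fun n => if n = 0 then 1 else B (n - 1), fun n => ?_, ?_⟩
    · dsimp only
      split_ifs
      · exact one_ne_zero
      · exact hB _
    · rw [hR, opD_mul_diag]
      simp

end Wilson

end UmbralWilson

end

theorem mainTheorem4 (lam kap a r r' h β β' : ℂ)
    (hlam : lam ≠ 0) (hkap : kap ≠ 0) (hlk : 1 / kap - 1 / lam = 1 / 2)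
    (hl : ∀ n : ℕ, 1 + lam * n ≠ 0) (hk : ∀ n : ℕ, 1 + kap * n ≠ 0)
    (hβ : β = r * kap + (1 - r) * lam) (hβ' : β' = r' * kap + (1 - r') * lam)
    (hH : ∀ n : ℕ, wilsonRatio lam kap β β' h n ≠ 0) :
    -- for every Jacobi family with parameter `b`: its dual raising operator, conjugated with
    -- `F_θ`, is the Jacobi operator, and the polynomials are eigenfunctions of the second-order
    -- differential operator `(1 + λθ)² - (2aλ²/κ)(1 + bθ)D` with eigenvalues `(1 + λn)²`
    (∀ (b : ℂ) (hF : ∀ n : ℕ, jacobiRatio lam kap b n ≠ 0),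
      IsMonicFamily (jacobiG lam kap a b hF) ∧
      LinearEquiv.conj (ratioDiag (jacobiRatio lam kap b) hF)
        (dualRaising (jacobiG lam kap a b hF)) = jacobiOp lam kap a b ∧
      LinearEquiv.conj (jacobiG lam kap a b hF) (diag fun n => (1 + lam * n) ^ 2) =
        diag (fun n => (1 + lam * n) ^ 2)
          - (2 * a * lam ^ 2 / kap) • (diag (fun n => 1 + b * n) * opD)) ∧
    -- `G_W` is the operator of a monic family, and the only one whose dual raising operator,
    -- conjugated with `H_θ`, is the affine combination
    IsMonicFamily (wilsonG lam kap a β β' h hH) ∧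
    (∀ G : ℂ[X] ≃ₗ[ℂ] ℂ[X], IsMonicFamily G →
      (LinearEquiv.conj (ratioDiag (wilsonRatio lam kap β β' h) hH) (dualRaising G) =
          h • (diag (fun n => (1 + lam * n) ^ 2) * jacobiOp lam kap a β)
            + (1 - h) • jacobiOp lam kap a β' ↔
        G = wilsonG lam kap a β β' h hH)) ∧
    -- the three-term relation of this family
    dualRaising (wilsonG lam kap a β β' h hH) =
      mulX + diag (wilsonA lam kap a r r' h) + diag (wilsonB lam kap a r r' h) * opD ∧
    -- orthogonality, with the exact nondegeneracy condition (all `b_n ≠ 0`)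
    (IsOrthogonalFamily (wilsonG lam kap a β β' h hH) ↔
      a ≠ 0 ∧ ∀ n : ℕ,
        h * (1 + lam * n) ^ 2 * (r * (1 + kap * n) + (1 - r) * (1 + lam * (n + 1)))
          + (1 - h) * (r' * (1 + kap * n) + (1 - r') * (1 + lam * (n + 1))) ≠ 0) ∧
    (∀ m n : ℕ,
      moment (wilsonG lam kap a β β' h hH)
          (wilsonG lam kap a β β' h hH (X ^ m) * wilsonG lam kap a β β' h hH (X ^ n)) =
        if m = n then
          (n.factorial : ℂ) * ∏ k ∈ Finset.range n, wilsonB lam kap a r r' h k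
        else 0) ∧
    -- `C̃₂` is the invertible operator with `C̃₂ 1 = 1` and `C̃₂⁻¹ x C̃₂ = x - ℓ_θ`, and it sends
    -- `x ^ n` to `∏_{k < n} (x + ℓ_k)`
    (∀ T : ℂ[X] ≃ₗ[ℂ] ℂ[X],
      (T 1 = 1 ∧ LinearEquiv.conj T⁻¹ mulX = mulX - diag (wilsonShift lam kap a β h)) ↔
        T = shiftedOp (wilsonShift lam kap a β h)) ∧
    (∀ n : ℕ, shiftedOp (wilsonShift lam kap a β h) (X ^ n) =
      ∏ k ∈ Finset.range n,
        ((X : ℂ[X]) + C (2 * a * h * lam ^ 2 / kap * (1 + k) * (1 + β * k)))) := by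
  subst hβ hβ'
  have hG := isMonicFamily_wilsonG lam kap a (r * kap + (1 - r) * lam)
    (r' * kap + (1 - r') * lam) h hH
  have hR := dualRaising_wilsonG (a := a) hlam hkap hlk hl hk (r := r) (r' := r') rfl rfl hH
  have hJ := conj_dualRaising_wilsonG (a := a) hlam hkap hlk hl hk _ _ hH
  refine ⟨fun b hF => ⟨isMonicFamily_jacobiG lam kap a b hF,
    conj_dualRaising_jacobiG lam kap a b hF, conj_jacobiG_sq a b hlam hkap hlk hl hk hF⟩, hG,
    fun G hG' => ⟨fun hE => ?_, ?_⟩, hR, ?_, moment_family_mul hG hR,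
    eq_shiftedOp_iff _, shiftedOp_X_pow _⟩
  · exact eq_of_dualRaising_eq hG' hG ((LinearEquiv.conj _).injective (hE.trans hJ.symm))
  · rintro rfl
    exact hJ
  · rw [isOrthogonalFamily_iff hG hR,
      forall_congr' fun n => wilsonB_ne_zero_iff hlam hkap hlk hl hk r r' hH n, forall_and,
      forall_const]
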